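/- A Markov automaton (MA) $\mathcal M$ has a finite set $S$ of states with an initial state $s_I$, a finite set $Act$ of actions containing a distinguished action $\bot$, and transitions $s \xrightarrow{\ell} \mu$, where $\ell$ is an action (probabilistic transition, instantaneous) or a rate in $\mathbb R_{>0}$ (Markovian transition) and $\mu$ is a probability distribution on $S$. Every state has at most one Markovian transition and at most one transition for each action; every state has some transition; and no state has both kinds. So $S = PS \uplus MS$ (probabilistic and Markovian states). For $s\in MS$ let $E(s)$ be its rate, and let $\lambda_{\max} = \max_{s\in MS} E(s)$. Let $P(s,\alpha,s')=\mu(s')$ if $s\xrightarrow{\alpha}\mu$, or if $\alpha=\bot$ and $s\xrightarrow{E(s)}\mu$; otherwise $P(s,\alpha,s')=0$. An action $\alpha$ is enabled at $s$ if $P(s,\alpha,s')>0$ for some $s'$. An infinite path $s_0\xrightarrow{\kappa_0}s_1\xrightarrow{\kappa_1}\cdots$ starts in $s_0=s_I$, has stamps $\kappa_i\in Act$ if $s_i\in PS$ and $\kappa_i\in\mathbb R_{\ge0}$ (a sojourn time) if $s_i\in MS$, has $P(s_i,\alpha(\kappa_i),s_{i+1})>0$ for all $i$, and satisfies $\sum_i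 t(\kappa_i)=\infty$; here $\alpha(\kappa)=\kappa$, $t(\kappa)=0$ for $\kappa \in Act$, and $\alpha(\kappa)=\bot$, $t(\kappa)=\kappa$ for sojourn times. Finite paths are the finite prefixes ending in a state. A generic scheduler $\sigma$ assigns, measurably, to each finite path a probability distribution over the actions enabled at its last state. It induces a probability measure $\Pr^{\mathcal M}_\sigma$: in a probabilistic state, action $\alpha$ and successor $s'$ are chosen with probability $\sigma(\pi,\alpha)P(s,\alpha,s')$; in a Markovian state, the sojourn time is exponential with rate $E(s)$ and the successor is independently chosen by $P(s,\bot,\cdot)$. Assume that $\mathcal M$ has no Zeno behaviour: under every generic scheduler, the total elapsed time is infinite with probability one. For $\delta>0$, the digitization $\mathcal M_\delta$ is the Markov decision process with states $S$, initial state $s_I$, actions $Act$, and transition probabilities $P_\delta(s,\bot,s') = P(s,\bot,s')(1-e^{-E(s)\delta}) + [s=s']\,e^{-E(s)\delta}$ for $s\in MS$, and $P_\delta(s,\alpha,s')=P(s,\alpha,s')$ otherwise. The digitization $\mathrm{di}(\pi)$ of a path $\pi$ replaces each $s_i\xrightarrow{\kappa_i}s_{i+1}$ by $m_i=\lfloor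 t(\kappa_i)/\delta\rfloor$ self-loops $s_i\xrightarrow{\bot}s_i$ followed by $s_i\xrightarrow{\alpha(\kappa_i)}s_{i+1}$. For a finite path $\bar\pi$ of $\mathcal M_\delta$ let $\langle\bar\pi\rangle$ be the set of finite paths $\pi$ of $\mathcal M$ with $\mathrm{di}(\pi)=\bar\pi$. The probability of a set of finite paths is that of its cylinder, i.e. of the set of infinite paths with a prefix in it. A digitization $\mathrm{di}(\sigma)$ of $\sigma$ is a scheduler of $\mathcal M_\delta$ with $$\mathrm{di}(\sigma)(\bar\pi,\alpha)=\int_{\pi\in\langle\bar\pi\rangle}\sigma(\pi,\alpha)\,d\Pr^{\mathcal M}_\sigma(\pi\mid\langle\bar\pi\rangle)$$ for all $\alpha\in Act$ and all finite paths $\bar\pi$ of $\mathcal M_\delta$ that end in $PS$ and satisfy $\Pr^{\mathcal M}_\sigma(\langle\bar\pi\rangle)>0$. Let $I=[a,b]$ with $0\le a<b$, or $I=[a,\infty)$ with $0\le a$, be well-formed: $k_a=a/\delta\in\mathbb N$ and, in the first case, $k_b=b/\delta\in\mathbb N$. Put $\mathrm{di}(I)=\{k\in\mathbb N\mid k\delta\in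 I\}$ if $a=0$ and $\mathrm{di}(I)=\{k\in\mathbb N\mid k\delta\in I\}\setminus\{k_a\}$ if $a>0$. For $G\subseteq S$ let $\Diamond^IG$ be the set of infinite paths of $\mathcal M$ for which some $n$ has $s_n\in G$ and $I\cap[t,t+t(\kappa_n)]\ne\emptyset$, where $t=\sum_{i<n}t(\kappa_i)$. Let $\Diamond_{ds}^{\mathrm{di}(I)}G$ be the set of infinite paths $\bar s_0\xrightarrow{\alpha_0}\bar s_1\xrightarrow{\alpha_1}\cdots$ of $\mathcal M_\delta$ for which some $n$ has $\bar s_n\in G$ and $|\{i<n\mid \bar s_i\in MS\}|\in\mathrm{di}(I)$. Set $\varepsilon_l(I)=0$ if $a=0$, and $\varepsilon_l(I)=1-(1+\lambda_{\max}\delta)^{k_a}e^{-\lambda_{\max}a}$ if $a>0$. Set $\varepsilon_u([0,\infty))=0$ and $\varepsilon_u([0,b])=1-(1+\lambda_{\max}\delta)^{k_b}e^{-\lambda_{\max}b}$; for $a>0$ set $\varepsilon_u([a,\infty))=1-e^{-\lambda_{\max}\delta}$ and $\varepsilon_u([a,b])=1-(1+\lambda_{\max}\delta)^{k_b}e^{-\lambda_{\max}b}+1-e^{-\lambda_{\max}\delta}$.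 Then for every generic scheduler $\sigma$ of $\mathcal M$, every $G\subseteq S$, every $\delta>0$ and every well-formed $I$, a digitization of $\sigma$ exists, and every digitization $\mathrm{di}(\sigma)$ of $\sigma$ satisfies $$\Pr^{\mathcal M}_\sigma(\Diamond^IG)\in\Pr^{\mathcal M_\delta}_{\mathrm{di}(\sigma)}\bigl(\Diamond_{ds}^{\mathrm{di}(I)}G\bigr)+\bigl[-\varepsilon_l(I),\,\varepsilon_u(I)\bigr].$$ -/

import Mathlib

open MeasureTheory ProbabilityTheory Finset
open scoped ENNReal NNReal BigOperators

noncomputable section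

namespace MarkovAut

/-! ### Runs and their laws

A run with label type `B` and state type `S` starting in `s₀` is a sequence of steps
`(label, successor state)`; the initial state is not stored. -/

/-- The last state of the finite run `l` that starts in `s₀`. -/
def lastState {B S : Type*} (s₀ : S) (l : List (B × S)) : S := (l.map Prod.snd).getLastD s₀

/-- The `n`-th state of the infinite run `ω` that starts in `s₀`. -/
def stateAt {B S : Type*} (s₀ : S) (ω : ℕ → B × S) : ℕ → S
  | 0 => s₀
  | n + 1 => (ω n).2

/-- The prefix of length `n` of an infinite run. -/
def pref {X : Type*} (ω : ℕ → X) (n : ℕ) : List X := List.ofFn fun i : Fin n => ω i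

/-- The cylinder of a set of finite runs: the infinite runs that have a prefix in `A`. -/
def cyl {X : Type*} (A : Set (List X)) : Set (ℕ → X) := {ω | ∃ n, pref ω n ∈ A}

/-- A family of one-step laws, one for each finite history. Measurability in the history refers to
the disjoint union of the product σ-algebras on the histories of length `n`. -/
structure StepLaw (X : Type*) [MeasurableSpace X] where
  toFun : List X → Measure X
  isProb : ∀ w, IsProbabilityMeasure (toFun w)
  meas : ∀ n, Measurable fun w : Fin n → X => toFun (List.ofFn w)

namespace StepLaw

variable {X : Type*} [MeasurableSpace X]

/-- The one-step law after `n + 1` steps, as a Markov kernel. -/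
def kernel (L : StepLaw X) (n : ℕ) : Kernel (∀ _ : Finset.Iic n, X) X where
  toFun h := L.toFun (List.ofFn fun i : Fin (n + 1) =>
    h ⟨i, Finset.mem_Iic.2 (Nat.lt_succ_iff.1 i.2)⟩)
  measurable' := (L.meas (n + 1)).comp (measurable_pi_lambda _ fun _ => measurable_pi_apply _)

instance (L : StepLaw X) (n : ℕ) : IsMarkovKernel (L.kernel n) := ⟨fun _ => L.isProb _⟩

/-- The law on infinite sequences whose first step has law `L []` and whose next step, given the
history `w`, has law `L w` (Ionescu-Tulcea). -/
def runMeasure (L : StepLaw X) : Measure (ℕ → X) :=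
  Kernel.trajMeasure (X := fun _ => X) (L.toFun []) L.kernel

instance (L : StepLaw X) : IsProbabilityMeasure L.runMeasure := by
  have := L.isProb []
  unfold runMeasure
  infer_instance

end StepLaw

/-- The weights `f` form a probability distribution supported on the actions in `E`. -/
structure IsDistOn {Act : Type*} [Fintype Act] (f : Act → ℝ) (E : Set Act) : Prop where
  nonneg : ∀ α, 0 ≤ f α
  sum_one : ∑ α, f α = 1
  support : ∀ α, α ∉ E → f α = 0

/-! ### Markov automata -/

/-- Action-deterministic Markov automata without terminal states and with maximal progress. -/
structure MarkovAutomaton (S Act : Type*) [Fintype S] [Fintype Act] where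
  /-- initial state -/
  init : S
  /-- the action that stands for a Markovian transition -/
  tau : Act
  /-- the transitions; a label is an action or a positive rate -/
  trans : S → Act ⊕ {r : ℝ // 0 < r} → PMF S → Prop
  /-- every state has at most one Markovian transition -/
  markov_unique : ∀ s r r' μ μ', trans s (.inr r) μ → trans s (.inr r') μ' → r = r' ∧ μ = μ'
  /-- action determinism -/
  action_det : ∀ s α μ μ', trans s (.inl α) μ → trans s (.inl α) μ' → μ = μ'
  /-- no terminal states -/
  no_terminal : ∀ s, ∃ l μ, trans s l μ
  /-- maximal progress -/
  max_progress : ∀ s α μ r ν, trans s (.inl α) μ → ¬ trans s (.inr r) ν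

/-- Markov decision processes (not necessarily free of terminal states). -/
structure MDP (S Act : Type*) [Fintype S] [Fintype Act] where
  /-- initial state -/
  init : S
  /-- transition probabilities -/
  P : S → Act → S → ℝ
  nonneg : ∀ s α s', 0 ≤ P s α s'
  sum_mem : ∀ s α, ∑ s', P s α s' = 0 ∨ ∑ s', P s α s' = 1

/-- A stamp is an action or a sojourn time. -/
abbrev Stamp (Act : Type*) := Act ⊕ ℝ≥0

/-- The time that passes according to a stamp. -/
def Stamp.time {Act : Type*} : Stamp Act → ℝ≥0
  | .inl _ => 0
  | .inr t => t

/-- A step of a run of a Markov automaton: the stamp and the successor state. -/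
abbrev TStep (S Act : Type*) := Stamp Act × S

/-- A step of a run of an MDP: the action and the successor state. -/
abbrev DStep (S Act : Type*) := Act × S

lemma measurable_lastState {B S : Type*} [MeasurableSpace B] [MeasurableSpace S] (s₀ : S) (n : ℕ) :
    Measurable fun w : Fin n → B × S => lastState s₀ (List.ofFn w) := by
  cases n with
  | zero => simp [lastState]
  | succ n =>
    have : (fun w : Fin (n + 1) → B × S => lastState s₀ (List.ofFn w)) =
        fun w => (w (Fin.last n)).2 := by
      funext w
      rw [lastState, List.map_ofFn, List.ofFn_succ', List.concat_eq_append]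
      simp
    rw [this]
    exact (measurable_pi_apply _).snd

lemma measurable_stamp {S Act : Type*} [MeasurableSpace S] [MeasurableSpace Act] (s' : S) :
    Measurable fun t : ℝ => ((Sum.inr t.toNNReal : Stamp Act), s') :=
  (measurable_inr.comp measurable_real_toNNReal).prodMk measurable_const

/-- Choosing an action by `f` and then a successor by `Q` gives total mass one. -/
lemma sum_branch {S Act : Type*} [Fintype S] [Fintype Act] {f : Act → ℝ} {Q : Act → S → ℝ}
    (hf : IsDistOn f {α | ∃ s', 0 < Q α s'}) (hQ : ∀ α s', 0 ≤ Q α s')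
    (hs : ∀ α, ∑ s', Q α s' = 0 ∨ ∑ s', Q α s' = 1) :
    ∑ α, ∑ s', ENNReal.ofReal (f α * Q α s') = 1 := by
  have h1 : ∀ α, ∑ s', ENNReal.ofReal (f α * Q α s') = ENNReal.ofReal (f α) := by
    intro α
    rw [← ENNReal.ofReal_sum_of_nonneg fun s' _ => mul_nonneg (hf.nonneg α) (hQ α s'),
      ← Finset.mul_sum]
    by_cases hα : ∃ s', 0 < Q α s'
    · obtain ⟨s', hs'⟩ := hα
      have : 0 < ∑ s', Q α s' :=
        lt_of_lt_of_le hs' (Finset.single_le_sum (fun i _ => hQ α i) (Finset.mem_univ s'))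
      rcases hs α with h | h
      · exact absurd h this.ne'
      · rw [h, mul_one]
    · rw [hf.support α hα, zero_mul]
  rw [Finset.sum_congr rfl fun α _ => h1 α,
    ← ENNReal.ofReal_sum_of_nonneg fun α _ => hf.nonneg α, hf.sum_one, ENNReal.ofReal_one]

namespace MDP

variable {S Act : Type*} [Fintype S] [Fintype Act] (D : MDP S Act)

/-- The actions enabled at `s`. -/
def enabled (s : S) : Set Act := {α | ∃ s', 0 < D.P s α s'}

/-- The infinite paths. -/
def IPaths : Set (ℕ → DStep S Act) :=
  {ω | ∀ i, 0 < D.P (stateAt D.init ω i) (ω i).1 (stateAt D.init ω (i + 1))}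

/-- The finite paths. -/
def FPaths : Set (List (DStep S Act)) := {l | ∃ ω ∈ D.IPaths, ∃ n, l = pref ω n}

/-- Schedulers of an MDP: they assign to every history a distribution over the actions that are
enabled at its last state. The values on histories that are not finite paths have no influence. -/
structure Scheduler where
  toFun : List (DStep S Act) → Act → ℝ
  isDist : ∀ w, IsDistOn (toFun w) (D.enabled (lastState D.init w))

variable [MeasurableSpace S] [MeasurableSingletonClass S]
  [MeasurableSpace Act] [MeasurableSingletonClass Act]

/-- The one-step law: action `α` and successor `s'` have probability `σ w α * P s α s'`. -/
def stepLaw (σ : D.Scheduler) : StepLaw (DStep S Act) where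
  toFun w := ∑ α, ∑ s', ENNReal.ofReal (σ.toFun w α * D.P (lastState D.init w) α s') •
    Measure.dirac (α, s')
  isProb w := ⟨by
    simp only [Measure.coe_finsetSum, Finset.sum_apply, Measure.smul_apply, smul_eq_mul,
      measure_univ, mul_one]
    exact sum_branch (σ.isDist w) (D.nonneg _) (D.sum_mem _)⟩
  meas _ := measurable_of_finite _

/-- The probability measure on infinite runs of the MDP under the scheduler `σ`. -/
def prob (σ : D.Scheduler) : Measure (ℕ → DStep S Act) := (D.stepLaw σ).runMeasure

end MDP

namespace MarkovAutomaton

variable {S Act : Type*} [Fintype S] [Fintype Act] (M : MarkovAutomaton S Act)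

/-- Probabilistic states. -/
def PS : Set S := {s | ∃ α μ, M.trans s (.inl α) μ}

/-- Markovian states. -/
def MS : Set S := {s | ∃ r μ, M.trans s (.inr r) μ}

open Classical in
/-- The exit rate of a Markovian state (`0` at the other states). -/
def exitRate (s : S) : ℝ :=
  if h : ∃ r : {r : ℝ // 0 < r}, ∃ μ, M.trans s (.inr r) μ then (h.choose : ℝ) else 0

/-- `s` moves under `α` according to `μ`, where the Markovian transition has action `tau`. -/
def Moves (s : S) (α : Act) (μ : PMF S) : Prop :=
  M.trans s (.inl α) μ ∨ (α = M.tau ∧ ∃ r, M.trans s (.inr r) μ)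

open Classical in
/-- The transition probabilities. -/
def P (s : S) (α : Act) (s' : S) : ℝ :=
  if h : ∃ μ, M.Moves s α μ then (h.choose s').toReal else 0

/-- The actions enabled at `s`. -/
def enabled (s : S) : Set Act := {α | ∃ s', 0 < M.P s α s'}

/-- The maximal exit rate. -/
def rateMax : ℝ := sSup (M.exitRate '' M.MS)

variable {M} in
lemma mem_MS_of_not_mem_PS {s : S} (h : s ∉ M.PS) : s ∈ M.MS := by
  obtain ⟨l, μ, hl⟩ := M.no_terminal s
  rcases l with α | r
  · exact absurd ⟨α, μ, hl⟩ h
  · exact ⟨r, μ, hl⟩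

variable {M} in
lemma exitRate_eq {s : S} {r : {r : ℝ // 0 < r}} {μ : PMF S} (h : M.trans s (.inr r) μ) :
    M.exitRate s = r := by
  have h' : ∃ r : {r : ℝ // 0 < r}, ∃ μ, M.trans s (.inr r) μ := ⟨r, μ, h⟩
  rw [exitRate, dif_pos h']
  obtain ⟨ν, hν⟩ := h'.choose_spec
  rw [(M.markov_unique s _ _ _ _ hν h).1]

variable {M} in
lemma exitRate_pos {s : S} (h : s ∈ M.MS) : 0 < M.exitRate s := by
  obtain ⟨r, μ, h⟩ := h
  rw [exitRate_eq h]
  exact r.2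

variable {M} in
lemma moves_unique {s : S} {α : Act} {μ ν : PMF S} (h : M.Moves s α μ) (h' : M.Moves s α ν) :
    μ = ν := by
  rcases h with h | ⟨-, r, h⟩ <;> rcases h' with h' | ⟨-, r', h'⟩
  · exact M.action_det _ _ _ _ h h'
  · exact absurd h' (M.max_progress _ _ _ _ _ h)
  · exact absurd h (M.max_progress _ _ _ _ _ h')
  · exact (M.markov_unique _ _ _ _ _ h h').2

variable {M} in
lemma P_eq {s : S} {α : Act} {μ : PMF S} (h : M.Moves s α μ) (s' : S) :
    M.P s α s' = (μ s').toReal := by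
  have h' : ∃ μ, M.Moves s α μ := ⟨μ, h⟩
  rw [P, dif_pos h', moves_unique h'.choose_spec h]

variable {M} in
lemma sum_P_of_moves {s : S} {α : Act} {μ : PMF S} (h : M.Moves s α μ) :
    ∑ s', M.P s α s' = 1 := by
  simp_rw [P_eq h]
  rw [← ENNReal.toReal_sum fun s' _ => μ.apply_ne_top s', ← tsum_fintype (L := .unconditional _),
    μ.tsum_coe, ENNReal.toReal_one]

lemma P_nonneg (s : S) (α : Act) (s' : S) : 0 ≤ M.P s α s' := by
  unfold P
  split_ifs
  · exact ENNReal.toReal_nonneg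
  · exact le_rfl

lemma sum_P_mem (s : S) (α : Act) : ∑ s', M.P s α s' = 0 ∨ ∑ s', M.P s α s' = 1 := by
  by_cases h : ∃ μ, M.Moves s α μ
  · exact Or.inr (sum_P_of_moves h.choose_spec)
  · left
    simp [P, h]

variable {M} in
lemma sum_P_tau {s : S} (h : s ∈ M.MS) : ∑ s', M.P s M.tau s' = 1 := by
  obtain ⟨r, μ, h⟩ := h
  exact sum_P_of_moves (μ := μ) (Or.inr ⟨rfl, r, h⟩)

/-! ### Paths, schedulers and the probability measure -/

/-- The action that belongs to a stamp. -/
def act : Stamp Act → Act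
  | .inl α => α
  | .inr _ => M.tau

/-- The infinite paths: time diverges, every step has positive probability, and the stamps match
the types of the states. -/
def IPaths : Set (ℕ → TStep S Act) :=
  {ω | (∑' i, ((ω i).1.time : ℝ≥0∞)) = ∞ ∧ ∀ i,
    0 < M.P (stateAt M.init ω i) (M.act (ω i).1) (stateAt M.init ω (i + 1)) ∧
    (stateAt M.init ω i ∈ M.PS → (ω i).1.isLeft) ∧
    (stateAt M.init ω i ∈ M.MS → (ω i).1.isRight)}

/-- The finite paths. -/
def FPaths : Set (List (TStep S Act)) := {l | ∃ ω ∈ M.IPaths, ∃ n, l = pref ω n}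

variable [MeasurableSpace S] [MeasurableSingletonClass S]
  [MeasurableSpace Act] [MeasurableSingletonClass Act]

/-- Generic schedulers: measurable maps that assign to every history a distribution over the
actions that are enabled at its last state. The values on histories that are not finite paths have
no influence, and every scheduler given on the finite paths only extends to all histories. -/
structure Scheduler where
  toFun : List (TStep S Act) → Act → ℝ
  isDist : ∀ w, IsDistOn (toFun w) (M.enabled (lastState M.init w))
  meas : ∀ n α, Measurable fun w : Fin n → TStep S Act => toFun (List.ofFn w) α

open Classical in
/-- The one-step law after the history `w`. In a probabilistic state, action `α` and successor `s'`
have probability `σ w α * P s α s'`. In a Markovian state, the sojourn time is exponentially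
distributed with the exit rate, and the successor is independently chosen by `P s tau`. -/
def stepMeasure (σ : M.Scheduler) (w : List (TStep S Act)) : Measure (TStep S Act) :=
  if lastState M.init w ∈ M.PS then
    ∑ α, ∑ s', ENNReal.ofReal (σ.toFun w α * M.P (lastState M.init w) α s') •
      Measure.dirac (Sum.inl α, s')
  else
    ∑ s', ENNReal.ofReal (M.P (lastState M.init w) M.tau s') •
      (expMeasure (M.exitRate (lastState M.init w))).map
        fun t => ((Sum.inr t.toNNReal : Stamp Act), s')

/-- The one-step laws of a Markov automaton under the scheduler `σ`. -/
def stepLaw (σ : M.Scheduler) : StepLaw (TStep S Act) where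
  toFun := M.stepMeasure σ
  isProb w := ⟨by
    unfold stepMeasure
    split_ifs with h
    · simp only [Measure.coe_finsetSum, Finset.sum_apply, Measure.smul_apply, smul_eq_mul,
        measure_univ, mul_one]
      exact sum_branch (σ.isDist w) (M.P_nonneg _) (M.sum_P_mem _)
    · have hm := mem_MS_of_not_mem_PS h
      have := isProbabilityMeasure_expMeasure (exitRate_pos hm)
      have h1 : ∀ s' : S, ((expMeasure (M.exitRate (lastState M.init w))).map
          fun t => ((Sum.inr t.toNNReal : Stamp Act), s')) Set.univ = 1 := fun s' => by
        rw [Measure.map_apply (measurable_stamp s') MeasurableSet.univ, Set.preimage_univ,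
          measure_univ]
      simp only [Measure.coe_finsetSum, Finset.sum_apply, Measure.smul_apply, smul_eq_mul,
        h1, mul_one]
      rw [← ENNReal.ofReal_sum_of_nonneg fun s' _ => M.P_nonneg _ _ s', sum_P_tau hm,
        ENNReal.ofReal_one]⟩
  meas n := by
    have hl := measurable_lastState (B := Stamp Act) M.init n
    refine Measure.measurable_of_measurable_coe _ fun T hT => ?_
    have : (fun w : Fin n → TStep S Act => M.stepMeasure σ (List.ofFn w) T) = fun w =>
        @ite _ (lastState M.init (List.ofFn w) ∈ M.PS) (Classical.propDecidable _)
          (∑ α, ∑ s', ENNReal.ofReal (σ.toFun (List.ofFn w) α *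
            M.P (lastState M.init (List.ofFn w)) α s') *
            Measure.dirac ((Sum.inl α : Stamp Act), s') T)
          ((fun s => (∑ s', ENNReal.ofReal (M.P s M.tau s') *
            ((expMeasure (M.exitRate s)).map
              fun t => ((Sum.inr t.toNNReal : Stamp Act), s')) T))
            (lastState M.init (List.ofFn w))) := by
      funext w
      unfold stepMeasure
      split_ifs <;> simp
    rw [this]
    refine Measurable.ite (hl (Set.toFinite _).measurableSet) ?_ ?_
    · refine Finset.measurable_sum _ fun α _ => Finset.measurable_sum _ fun s' _ => ?_
      refine Measurable.mul_const ?_ _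
      exact ((σ.meas n α).mul
        ((measurable_of_finite fun s => M.P s α s').comp hl)).ennreal_ofReal
    · exact (measurable_of_finite fun s => ∑ s', ENNReal.ofReal (M.P s M.tau s') *
        ((expMeasure (M.exitRate s)).map
          fun t => ((Sum.inr t.toNNReal : Stamp Act), s')) T).comp hl

/-- The probability measure on infinite runs of the automaton under the scheduler `σ`. -/
def prob (σ : M.Scheduler) : Measure (ℕ → TStep S Act) := (M.stepLaw σ).runMeasure

/-- No Zeno behaviour: under every scheduler, infinitely many steps take place within finite time
with probability zero only. -/
def NonZeno : Prop :=
  ∀ σ : M.Scheduler, M.prob σ {ω | (∑' i, ((ω i).1.time : ℝ≥0∞)) ≠ ∞} = 0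

/-! ### Digitization -/

open Classical in
/-- The transition probabilities of the digitization with respect to `δ`. -/
def digP (δ : ℝ) (s : S) (α : Act) (s' : S) : ℝ :=
  if s ∈ M.MS ∧ α = M.tau then
    if s = s' then
      M.P s M.tau s' * (1 - Real.exp (-(M.exitRate s * δ))) + Real.exp (-(M.exitRate s * δ))
    else M.P s M.tau s' * (1 - Real.exp (-(M.exitRate s * δ)))
  else M.P s α s'

/-- The digitization of `M` with respect to `δ`. -/
def dig (δ : ℝ) (hδ : 0 < δ) : MDP S Act where
  init := M.init
  P := M.digP δ
  nonneg s α s' := by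
    unfold digP
    split_ifs with h h'
    · have h1 : Real.exp (-(M.exitRate s * δ)) ≤ 1 :=
        Real.exp_le_one_iff.2 (neg_nonpos.2 (mul_pos (exitRate_pos h.1) hδ).le)
      have := mul_nonneg (M.P_nonneg s M.tau s') (sub_nonneg.2 h1)
      have := Real.exp_pos (-(M.exitRate s * δ))
      linarith
    · have h1 : Real.exp (-(M.exitRate s * δ)) ≤ 1 :=
        Real.exp_le_one_iff.2 (neg_nonpos.2 (mul_pos (exitRate_pos h.1) hδ).le)
      exact mul_nonneg (M.P_nonneg s M.tau s') (sub_nonneg.2 h1)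
    · exact M.P_nonneg s α s'
  sum_mem s α := by
    by_cases h : s ∈ M.MS ∧ α = M.tau
    · right
      classical
      have : ∀ s', M.digP δ s α s' =
          M.P s M.tau s' * (1 - Real.exp (-(M.exitRate s * δ))) +
            if s = s' then Real.exp (-(M.exitRate s * δ)) else 0 := by
        intro s'
        unfold digP
        rw [if_pos h]
        split_ifs <;> simp
      simp_rw [this]
      rw [Finset.sum_add_distrib, ← Finset.sum_mul, sum_P_tau h.1]
      simp
    · simp only [digP, if_neg h]
      exact M.sum_P_mem s α

/-- The digitization of the finite run `l` that starts in `s`: before the step with stamp `κ` is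
taken, `⌊time κ / δ⌋` self-loops are taken at the current state. -/
def digFrom (δ : ℝ) : S → List (TStep S Act) → List (DStep S Act)
  | _, [] => []
  | s, (κ, s') :: l =>
    List.replicate ⌊(κ.time : ℝ) / δ⌋₊ (M.act κ, s) ++ (M.act κ, s') :: digFrom δ s' l

/-- The digitization of a finite path. -/
def digPath (δ : ℝ) (l : List (TStep S Act)) : List (DStep S Act) := M.digFrom δ M.init l

/-- The finite paths of `M` that are induced by the digital path `p`. -/
def induced (δ : ℝ) (p : List (DStep S Act)) : Set (List (TStep S Act)) :=
  {l | l ∈ M.FPaths ∧ M.digPath δ l = p}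

open Classical in
/-- The value `σ(π, α)` for the prefix `π` of `ω` that is induced by `p`; `0` if there is none.
There is at most one such `π`, as digitizing a longer prefix yields a longer path, and its length
is at most that of `p`. -/
def choiceAlong (δ : ℝ) (σ : M.Scheduler) (p : List (DStep S Act)) (α : Act)
    (ω : ℕ → TStep S Act) : ℝ :=
  ∑ n ∈ Finset.range (p.length + 1),
    if pref ω n ∈ M.induced δ p then σ.toFun (pref ω n) α else 0

/-- `τ` is a digitization of the scheduler `σ`: on each digital path `p` that ends in a
probabilistic state, it averages the choices of `σ` over the paths induced by `p`, weighted with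
their conditional probability. Where that conditional probability is undefined, `τ` is free; in
Markovian states there is only one enabled action. -/
def IsDigitization (δ : ℝ) (hδ : 0 < δ) (σ : M.Scheduler) (τ : (M.dig δ hδ).Scheduler) : Prop :=
  ∀ p ∈ (M.dig δ hδ).FPaths, lastState M.init p ∈ M.PS →
    M.prob σ (cyl (M.induced δ p)) ≠ 0 → ∀ α,
      τ.toFun p α = ∫ ω, M.choiceAlong δ σ p α ω ∂((M.prob σ)[|cyl (M.induced δ p)])

/-! ### Timed and digitization-step-bounded reachability -/

/-- The infinite paths of `M` that visit `G` at some time point in `I`. -/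
def timedReach (I : Set ℝ) (G : Set S) : Set (ℕ → TStep S Act) :=
  {ω | ω ∈ M.IPaths ∧ ∃ n, stateAt M.init ω n ∈ G ∧
    (I ∩ Set.Icc (∑ i ∈ Finset.range n, ((ω i).1.time : ℝ))
      ((∑ i ∈ Finset.range n, ((ω i).1.time : ℝ)) + (ω n).1.time)).Nonempty}

open Classical in
/-- The number of digitization steps among the first `n` steps of a digital path: the number of
transitions that leave Markovian states. -/
def numDS (ω : ℕ → DStep S Act) (n : ℕ) : ℕ :=
  #{i ∈ Finset.range n | stateAt M.init ω i ∈ M.MS}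

/-- The infinite digital paths that visit `G` after a number of digitization steps in `J`. -/
def dsReach (δ : ℝ) (hδ : 0 < δ) (J : Set ℕ) (G : Set S) : Set (ℕ → DStep S Act) :=
  {ω | ω ∈ (M.dig δ hδ).IPaths ∧ ∃ n, stateAt M.init ω n ∈ G ∧ M.numDS ω n ∈ J}

end MarkovAutomaton

/-- Time intervals `[a, b]` with `0 ≤ a < b`, and `[a, ∞)` with `0 ≤ a`. -/
inductive TimeInterval
  | bounded (a b : ℝ) (ha : 0 ≤ a) (hab : a < b)
  | unbounded (a : ℝ) (ha : 0 ≤ a)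

namespace TimeInterval

/-- The points of the interval. -/
def toSet : TimeInterval → Set ℝ
  | bounded a b _ _ => Set.Icc a b
  | unbounded a _ => Set.Ici a

/-- The left end point. -/
def lower : TimeInterval → ℝ
  | bounded a _ _ _ => a
  | unbounded a _ => a

/-- The end points are multiples of `δ`. -/
def WellFormed (δ : ℝ) : TimeInterval → Prop
  | bounded a b _ _ => (∃ k : ℕ, a / δ = k) ∧ ∃ k : ℕ, b / δ = k
  | unbounded a _ => ∃ k : ℕ, a / δ = k

/-- The digitization step bounds: all `k` with `k * δ` in the interval, without the left end point
if that is positive. -/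
def digSteps (δ : ℝ) (I : TimeInterval) : Set ℕ :=
  {k | (k : ℝ) * δ ∈ I.toSet} \ {k | 0 < I.lower ∧ (k : ℝ) * δ = I.lower}

/-- `1 - (1 + rate * δ) ^ k * exp (-(rate * t))` with `k = t / δ`, a natural number in the case of
well-formed intervals. -/
def stepError (rate δ t : ℝ) : ℝ := 1 - (1 + rate * δ) ^ ⌊t / δ⌋₊ * Real.exp (-(rate * t))

open Classical in
/-- The lower error bound. -/
def errLower (rate δ : ℝ) (I : TimeInterval) : ℝ :=
  if I.lower = 0 then 0 else stepError rate δ I.lower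

open Classical in
/-- The upper error bound. -/
def errUpper (rate δ : ℝ) : TimeInterval → ℝ
  | bounded a b _ _ =>
    if a = 0 then stepError rate δ b else stepError rate δ b + (1 - Real.exp (-(rate * δ)))
  | unbounded a _ => if a = 0 then 0 else 1 - Real.exp (-(rate * δ))

end TimeInterval

end MarkovAut

end

/-! The proof puts both probabilities on one space. Each timed run is digitized: a sojourn of length
t becomes ⌊t/δ⌋ self-loops followed by the actual step. Under a digitization of the scheduler, the
run of the digitized automaton has exactly the law of this digitized run (`measure_digRun_cyl`, by
induction on the digital path). In a Markovian state the reason is memorylessness: a sojourn that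
has lasted j units lasts one more with probability e^{-E(s)δ}, whatever the timed history, and the
successor is independent of it (`stepMeasure_passingTo_MS`). In a probabilistic state the defining
average of the digitized scheduler is what is needed (`stepMeasure_passingTo_PS`,
`IsDigitization.mul_measure`). Non-Zenoness makes almost every run a path, so exceptional runs can
be ignored.

What remains is a comparison of two events on timed runs. Every sojourn is rounded up, so the
elapsed time never exceeds δ times the number of digitization steps. Hence the events differ only
for two reasons. One is an overrun: more than k steps are taken within time kδ. At k_a this can make
the digital run succeed alone, at k_b the timed run. The other is a sojourn that ends in step number
k_a: it may cover time a although its step counts do not go beyond k_a. See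
`exists_digSteps_of_timedReach` and `timedReach_of_digSteps`.

With λ the maximal rate, the overrun probability is controlled by the potential (1+λδ)^j e^{-λR},
where j steps and time R remain, replaced by 0 after an overrun and by 1 once time has run out
without one. It is a submartingale (`potential_le_lintegral`), starts at (1+λδ)^k e^{-λkδ}, and is
at most the indicator of there being no overrun so far. The submartingale property reduces to one
sojourn (`le_lintegral_expMeasure`), where cutting time into units gives a geometric sum and 1+x ≤
e^x does the rest. For the second reason, at most one sojourn reaches step k_a, and given that one
does, it ends there with probability at most 1-e^{-λδ} (`measure_jump_le`). -/

set_option linter.unusedSectionVars false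

noncomputable section

namespace MarkovAut

/-! ### Prefixes and last states -/

section Runs

variable {X : Type*}

@[simp] lemma pref_zero (ω : ℕ → X) : pref ω 0 = [] := by simp [pref]

lemma pref_succ (ω : ℕ → X) (n : ℕ) : pref ω (n + 1) = pref ω n ++ [ω n] := by
  rw [pref, List.ofFn_succ', List.concat_eq_append]; rfl

@[simp] lemma length_pref (ω : ℕ → X) (n : ℕ) : (pref ω n).length = n := by simp [pref]

lemma pref_eq_append_iff {ω : ℕ → X} {n : ℕ} {p : List X} {x : X} :
    pref ω (n + 1) = p ++ [x] ↔ pref ω n = p ∧ ω n = x := by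
  rw [pref_succ, ← List.concat_eq_append, ← List.concat_eq_append, List.concat_inj]

@[simp] lemma lastState_nil {B S : Type*} (s : S) : lastState s ([] : List (B × S)) = s := rfl

@[simp] lemma lastState_append_singleton {B S : Type*} (s : S) (l : List (B × S)) (x : B × S) :
    lastState s (l ++ [x]) = x.2 := by simp [lastState]

@[simp] lemma lastState_pref {B S : Type*} (s : S) (ω : ℕ → B × S) (n : ℕ) :
    lastState s (pref ω n) = stateAt s ω n := by
  cases n with
  | zero => simp [stateAt]
  | succ n => simp [pref_succ, stateAt]

lemma lastState_append {B S : Type*} (s : S) (l l' : List (B × S)) :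
    lastState s (l ++ l') = lastState (lastState s l) l' := by
  induction l' using List.reverseRecOn with
  | nil => simp
  | append_singleton l' x _ => 
    rw [← List.append_assoc, lastState_append_singleton, lastState_append_singleton]

lemma lastState_replicate {B S : Type*} (s : S) (b : B) (j : ℕ) :
    lastState s (List.replicate j (b, s)) = s := by
  cases j with
  | zero => rfl
  | succ j => rw [List.replicate_succ', lastState_append_singleton]

end Runs

/-! ### Conditioning the run measure on a finite history -/

namespace StepLaw

variable {X : Type*} [MeasurableSpace X]

lemma map_eval_zero (L : StepLaw X) : L.runMeasure.map (fun ω => ω 0) = L.toFun [] := by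
  have := L.isProb []
  have h0 : (fun ω : ℕ → X => ω 0) =
      (fun y : (∀ _ : Finset.Iic 0, X) => y default) ∘ Preorder.frestrictLe 0 := rfl
  have hf : Measurable (Preorder.frestrictLe (π := fun _ : ℕ => X) 0) := by fun_prop
  rw [h0, ← Measure.map_map (by fun_prop) hf, runMeasure, Kernel.trajMeasure,
    Measure.map_comp _ _ hf, Kernel.traj_map_frestrictLe, Kernel.partialTraj_self, Measure.id_comp,
    Measure.map_map (by fun_prop) (by fun_prop)]
  exact Measure.map_id

/-- The law of a finite history together with the next step. -/
lemma lintegral_step (L : StepLaw X) (n : ℕ) {f : List X → X → ℝ≥0∞}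
    (hf : Measurable fun z : (Fin n → X) × X => f (List.ofFn z.1) z.2) :
    ∫⁻ ω, f (pref ω n) (ω n) ∂L.runMeasure =
      ∫⁻ ω, ∫⁻ x, f (pref ω n) x ∂(L.toFun (pref ω n)) ∂L.runMeasure := by
  cases n with
  | zero =>
    have hf' : Measurable (f []) :=
      hf.comp (f := fun x : X => ((Fin.elim0 : Fin 0 → X), x)) (by fun_prop)
    simp only [pref_zero, lintegral_const, measure_univ, mul_one]
    rw [← map_eval_zero, lintegral_map hf' (by fun_prop)]
  | succ n =>
    -- The kernel with index `n` sees the coordinates 0, ..., n, that is, a history of length `n +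
    -- 1`; the empty history is governed by the initial law instead.
    let e : (∀ _ : Finset.Iic n, X) → Fin (n + 1) → X := fun h i =>
      h ⟨i, Finset.mem_Iic.2 (Nat.lt_succ_iff.1 i.2)⟩
    have he : Measurable e := measurable_pi_lambda _ fun _ => measurable_pi_apply _
    have hg : Measurable fun z : (∀ _ : Finset.Iic n, X) × X => f (List.ofFn (e z.1)) z.2 :=
      hf.comp (f := fun z : (∀ _ : Finset.Iic n, X) × X => (e z.1, z.2)) (by fun_prop)
    have hr : Measurable (Preorder.frestrictLe (π := fun _ : ℕ => X) n) := by fun_prop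
    have := L.isProb []
    have key := Kernel.map_frestrictLe_trajMeasure_compProd_eq_map_trajMeasure
      (X := fun _ : ℕ => X) (μ₀ := L.toFun []) (κ := L.kernel) (a := n)
    calc ∫⁻ ω, f (pref ω (n + 1)) (ω (n + 1)) ∂L.runMeasure
        = ∫⁻ z, f (List.ofFn (e z.1)) z.2 ∂(L.runMeasure.map
            fun ω => (Preorder.frestrictLe (π := fun _ : ℕ => X) n ω, ω (n + 1))) := by
          rw [lintegral_map hg (by fun_prop)]; rfl
      _ = _ := by
          rw [runMeasure, ← key, Measure.lintegral_compProd hg, lintegral_map _ hr]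
          · rfl
          · exact hg.lintegral_kernel_prod_right'

/-- The measure of a set described by a finite history and the next step. -/
lemma measure_step (L : StepLaw X) (n : ℕ) {A : List X → X → Prop}
    (hA : MeasurableSet {z : (Fin n → X) × X | A (List.ofFn z.1) z.2}) :
    L.runMeasure {ω | A (pref ω n) (ω n)} =
      ∫⁻ ω, L.toFun (pref ω n) {x | A (pref ω n) x} ∂L.runMeasure := by
  have hm : Measurable fun ω : ℕ → X => ((fun i : Fin n => ω i), ω n) := by fun_prop
  have h1 : MeasurableSet {ω : ℕ → X | A (pref ω n) (ω n)} := hm hA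
  have h2 : ∀ w : Fin n → X, MeasurableSet {x | A (List.ofFn w) x} := fun w =>
    (measurable_prodMk_left (x := w)) hA
  have := L.lintegral_step n (f := fun w x => {x | A w x}.indicator 1 x)
    ((measurable_const (a := (1 : ℝ≥0∞))).indicator hA)
  rw [← lintegral_indicator_one h1]
  refine Eq.trans ?_ (this.trans ?_)
  · rfl
  · refine lintegral_congr fun ω => ?_
    rw [lintegral_indicator_one]
    exact h2 _

/-- A property of steps that holds almost surely after every history holds almost surely along
the run. -/
lemma ae_step (L : StepLaw X) (n : ℕ) {A : List X → X → Prop}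
    (hA : MeasurableSet {z : (Fin n → X) × X | A (List.ofFn z.1) z.2})
    (h : ∀ w, ∀ᵐ x ∂(L.toFun w), A w x) : ∀ᵐ ω ∂L.runMeasure, A (pref ω n) (ω n) := by
  rw [ae_iff, L.measure_step n (A := fun w x => ¬ A w x) hA.compl]
  simp only [fun w => ae_iff.1 (h w), lintegral_zero]

end StepLaw

/-! ### Elapsed time against digitization steps -/

/-- The number of full time units of length `δ` that pass according to a stamp. -/
def Stamp.units {Act : Type*} (δ : ℝ) (κ : Stamp Act) : ℕ := ⌊(κ.time : ℝ) / δ⌋₊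

/-- The number of digitization steps that a stamp amounts to. -/
def Stamp.cost {Act : Type*} (δ : ℝ) : Stamp Act → ℕ
  | .inl _ => 0
  | .inr t => ⌊(t : ℝ) / δ⌋₊ + 1

@[simp] lemma Stamp.units_inl {Act : Type*} (δ : ℝ) (α : Act) :
    Stamp.units δ (.inl α : Stamp Act) = 0 := by simp [Stamp.units, Stamp.time]

@[simp] lemma Stamp.cost_inl {Act : Type*} (δ : ℝ) (α : Act) :
    Stamp.cost δ (.inl α : Stamp Act) = 0 := rfl

lemma Stamp.cost_inr {Act : Type*} (δ : ℝ) (t : ℝ≥0) :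
    Stamp.cost δ (.inr t : Stamp Act) = Stamp.units δ (.inr t : Stamp Act) + 1 := rfl

lemma Stamp.cost_eq {Act : Type*} (δ : ℝ) {κ : Stamp Act} (h : κ.isRight) :
    κ.cost δ = κ.units δ + 1 := by
  rcases κ with α | t
  · simp at h
  · rfl

lemma Stamp.time_le_cost {Act : Type*} {δ : ℝ} (hδ : 0 < δ) (κ : Stamp Act) :
    (κ.time : ℝ) ≤ κ.cost δ * δ := by
  rcases κ with α | t
  · simp [Stamp.time]
  · have := (Nat.lt_floor_add_one ((t : ℝ) / δ)).le
    rw [div_le_iff₀ hδ] at this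
    simpa [Stamp.time, Stamp.cost] using this

/-- The time that passes along a finite run. -/
def elapsed {S Act : Type*} (l : List (TStep S Act)) : ℝ := (l.map fun x => (x.1.time : ℝ)).sum

/-- The number of digitization steps of a finite run. -/
def digCount {S Act : Type*} (δ : ℝ) (l : List (TStep S Act)) : ℕ :=
  (l.map fun x => x.1.cost δ).sum

section Counting

variable {S Act : Type*}

@[simp] lemma elapsed_nil : elapsed ([] : List (TStep S Act)) = 0 := rfl

@[simp] lemma elapsed_append_singleton (l : List (TStep S Act)) (x : TStep S Act) :
    elapsed (l ++ [x]) = elapsed l + x.1.time := by simp [elapsed]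

@[simp] lemma digCount_nil (δ : ℝ) : digCount δ ([] : List (TStep S Act)) = 0 := rfl

@[simp] lemma digCount_append_singleton (δ : ℝ) (l : List (TStep S Act)) (x : TStep S Act) :
    digCount δ (l ++ [x]) = digCount δ l + x.1.cost δ := by simp [digCount]

lemma elapsed_pref (ω : ℕ → TStep S Act) (n : ℕ) :
    elapsed (pref ω n) = ∑ i ∈ Finset.range n, ((ω i).1.time : ℝ) := by
  induction n with
  | zero => simp
  | succ n ih => simp [pref_succ, ih, Finset.sum_range_succ]

/-- Each sojourn is rounded up to whole units, so digital time is never behind real time. This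
one-sidedness is what makes the two error bounds asymmetric. -/
lemma elapsed_le_digCount {δ : ℝ} (hδ : 0 < δ) (l : List (TStep S Act)) :
    elapsed l ≤ digCount δ l * δ := by
  induction l using List.reverseRecOn with
  | nil => simp
  | append_singleton l x ih =>
    have := Stamp.time_le_cost hδ x.1
    simp only [elapsed_append_singleton, digCount_append_singleton, Nat.cast_add, add_mul]
    linarith

end Counting

/-! ### Pathwise digitization of infinite runs -/

namespace MarkovAutomaton

variable {S Act : Type*} [Fintype S] [Fintype Act] (M : MarkovAutomaton S Act)

variable {M} in
lemma not_mem_MS_of_mem_PS {s : S} (h : s ∈ M.PS) : s ∉ M.MS := by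
  rintro ⟨r, ν, hν⟩
  obtain ⟨α, μ, hμ⟩ := h
  exact M.max_progress _ _ _ _ _ hμ hν

variable {M} in
lemma not_mem_PS_of_mem_MS {s : S} (h : s ∈ M.MS) : s ∉ M.PS :=
  fun h' => not_mem_MS_of_mem_PS h' h

/-- The stamp has the type that belongs to the state. -/
def Fits (s : S) (κ : Stamp Act) : Prop := (s ∈ M.PS → κ.isLeft) ∧ (s ∈ M.MS → κ.isRight)

variable {M} in
lemma Fits.isRight_iff {s : S} {κ : Stamp Act} (h : M.Fits s κ) : κ.isRight ↔ s ∈ M.MS := by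
  refine ⟨fun hr => mem_MS_of_not_mem_PS fun hp => ?_, h.2⟩
  have := h.1 hp
  rcases κ with α | t <;> simp at this hr

variable {M} in
lemma Fits.cost_eq {s : S} {κ : Stamp Act} (h : M.Fits s κ) (δ : ℝ) (hs : s ∈ M.MS) :
    κ.cost δ = κ.units δ + 1 := Stamp.cost_eq δ (h.2 hs)

variable {M} in
lemma Fits.eq_inl {s : S} {κ : Stamp Act} (h : M.Fits s κ) (hs : s ∉ M.MS) : ∃ α, κ = .inl α := by
  rcases κ with α | t
  · exact ⟨α, rfl⟩
  · exact absurd (h.isRight_iff.1 rfl) hs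

variable {M} in
lemma fits_of_mem_IPaths {ω : ℕ → TStep S Act} (h : ω ∈ M.IPaths) (n : ℕ) :
    M.Fits (stateAt M.init ω n) (ω n).1 := (h.2 n).2

lemma digFrom_append (δ : ℝ) (s : S) (l l' : List (TStep S Act)) :
    M.digFrom δ s (l ++ l') = M.digFrom δ s l ++ M.digFrom δ (lastState s l) l' := by
  induction l generalizing s with
  | nil => simp [digFrom]
  | cons x l ih =>
    obtain ⟨κ, s'⟩ := x
    have : lastState s ((κ, s') :: l) = lastState s' l := by
      rw [← List.singleton_append, lastState_append]; rfl
    simp [digFrom, ih, this]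

lemma digPath_append_singleton (δ : ℝ) (l : List (TStep S Act)) (x : TStep S Act) :
    M.digPath δ (l ++ [x]) = M.digPath δ l ++
      (List.replicate (x.1.units δ) (M.act x.1, lastState M.init l) ++ [(M.act x.1, x.2)]) := by
  rw [digPath, digFrom_append]
  rfl

/-- The self-loops come before the actual step, so every block ends in the successor of the timed
step. -/
lemma lastState_digPath (δ : ℝ) (l : List (TStep S Act)) :
    lastState M.init (M.digPath δ l) = lastState M.init l := by
  induction l using List.reverseRecOn with
  | nil => rfl
  | append_singleton l x ih =>
    rw [digPath_append_singleton, ← List.append_assoc, lastState_append_singleton,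
      lastState_append_singleton]

/-- The digital path that leads through the finite run `l` and the first `j` self-loops that
represent the next step `x`. -/
def digPartial (δ : ℝ) (l : List (TStep S Act)) (x : TStep S Act) (j : ℕ) : List (DStep S Act) :=
  M.digPath δ l ++ List.replicate j (M.act x.1, lastState M.init l)

lemma lastState_digPartial (δ : ℝ) (l : List (TStep S Act)) (x : TStep S Act) (j : ℕ) :
    lastState M.init (M.digPartial δ l x j) = lastState M.init l := by
  rw [digPartial, lastState_append, lastState_digPath, lastState_replicate]

/-- The digital step that follows the first `j` self-loops representing the step `x` from `s`. -/
def nextDig (δ : ℝ) (s : S) (x : TStep S Act) (j : ℕ) : DStep S Act :=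
  (M.act x.1, if j < x.1.units δ then s else x.2)

/-- The position in the timed run `ω` that is reached after `k` steps of its digitization: the
number of completed steps, and the number of self-loops taken thereafter. -/
def digPos (δ : ℝ) (ω : ℕ → TStep S Act) : ℕ → ℕ × ℕ
  | 0 => (0, 0)
  | k + 1 => if (digPos δ ω k).2 < (ω (digPos δ ω k).1).1.units δ then
      ((digPos δ ω k).1, (digPos δ ω k).2 + 1) else ((digPos δ ω k).1 + 1, 0)

/-- The digitization of an infinite run. -/
def digRun (δ : ℝ) (ω : ℕ → TStep S Act) (k : ℕ) : DStep S Act :=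
  M.nextDig δ (stateAt M.init ω (digPos δ ω k).1) (ω (digPos δ ω k).1) (digPos δ ω k).2

section Pathwise

variable {δ : ℝ} {ω : ℕ → TStep S Act}

omit [Fintype S] [Fintype Act] in
lemma digPos_snd_le (k : ℕ) : (digPos δ ω k).2 ≤ (ω (digPos δ ω k).1).1.units δ := by
  cases k with
  | zero => simp [digPos]
  | succ k =>
    rw [digPos]
    split_ifs with h
    · exact h
    · simp

omit [Fintype S] [Fintype Act] in
lemma digPos_fst_le (k : ℕ) : (digPos δ ω k).1 ≤ k := by
  induction k with
  | zero => simp [digPos]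
  | succ k ih =>
    rw [digPos]
    split_ifs <;> simp <;> omega

/-- A self-loop lengthens the unfinished block. Otherwise the block already holds all its
self-loops, by `digPos_snd_le`, and the actual step turns it into the next piece of the digitized
prefix. -/
lemma pref_digRun (k : ℕ) : pref (M.digRun δ ω) k =
    M.digPartial δ (pref ω (digPos δ ω k).1) (ω (digPos δ ω k).1) (digPos δ ω k).2 := by
  induction k with
  | zero => simp [digPos, digPartial, digPath, digFrom]
  | succ k ih =>
    rw [pref_succ, ih, digRun, nextDig, digPos]
    split_ifs with h
    · simp only [digPartial, lastState_pref, List.replicate_succ', List.append_assoc]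
    · have := (digPos_snd_le (δ := δ) (ω := ω) k).antisymm (not_lt.1 h)
      simp only [digPartial, lastState_pref, pref_succ, digPath_append_singleton, this,
        List.append_assoc, List.replicate_zero, List.append_nil]

lemma stateAt_digRun (k : ℕ) :
    stateAt M.init (M.digRun δ ω) k = stateAt M.init ω (digPos δ ω k).1 := by
  rw [← lastState_pref, pref_digRun, lastState_digPartial, lastState_pref]

omit [Fintype S] [Fintype Act] in
/-- Every position is reached. -/
lemma exists_digPos (n j : ℕ) (hj : j ≤ (ω n).1.units δ) : ∃ k, digPos δ ω k = (n, j) := by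
  induction n generalizing j with
  | zero =>
    induction j with
    | zero => exact ⟨0, rfl⟩
    | succ j ih =>
      obtain ⟨k, hk⟩ := ih (by omega)
      exact ⟨k + 1, by rw [digPos, hk, if_pos (by simpa using hj)]⟩
  | succ n ihn =>
    induction j with
    | zero =>
      obtain ⟨k, hk⟩ := ihn _ le_rfl
      exact ⟨k + 1, by rw [digPos, hk, if_neg (by simp)]⟩
    | succ j ih =>
      obtain ⟨k, hk⟩ := ih (by omega)
      exact ⟨k + 1, by rw [digPos, hk, if_pos (by simpa using hj)]⟩

/-- The digital path `p` leads to the position `(n, j)` if and only if it arises from the first `n`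
steps and `j` self-loops that represent the next one. -/
lemma pref_digRun_eq_iff (p : List (DStep S Act)) (n j : ℕ) :
    (pref (M.digRun δ ω) p.length = p ∧ digPos δ ω p.length = (n, j)) ↔
      j ≤ (ω n).1.units δ ∧ M.digPartial δ (pref ω n) (ω n) j = p := by
  constructor
  · rintro ⟨h, hp⟩
    have h1 := digPos_snd_le (δ := δ) (ω := ω) p.length
    have h2 := M.pref_digRun (δ := δ) (ω := ω) p.length
    rw [hp] at h1 h2
    exact ⟨h1, by rw [← h2, h]⟩
  · rintro ⟨hj, h⟩
    -- The position is reached at some time `k`, and comparing lengths forces `k` to be the length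
    -- of `p`. So a digital path determines its position in the run.
    obtain ⟨k, hk⟩ := exists_digPos n j hj
    have h1 := M.pref_digRun (δ := δ) (ω := ω) k
    rw [hk] at h1
    simp only [h] at h1
    have h2 : p.length = k := by rw [← h1]; simp
    exact ⟨by rw [h2, h1], by rw [h2, hk]⟩

/-- At a Markovian state each self-loop counts once and so does the completing step, which is the `+
1` in `Stamp.cost`. Elsewhere the stamp is an action, with neither units nor cost. -/
lemma numDS_digRun (hω : ∀ n, M.Fits (stateAt M.init ω n) (ω n).1) (k : ℕ) :
    M.numDS (M.digRun δ ω) k = digCount δ (pref ω (digPos δ ω k).1) + (digPos δ ω k).2 := by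
  induction k with
  | zero => simp [digPos, numDS]
  | succ k ih =>
    have h1 : M.numDS (M.digRun δ ω) (k + 1) = M.numDS (M.digRun δ ω) k +
        @ite _ (stateAt M.init (M.digRun δ ω) k ∈ M.MS) (Classical.propDecidable _) 1 0 := by
      rw [numDS, numDS, Finset.range_add_one, Finset.filter_insert]
      split_ifs
      · rw [Finset.card_insert_of_notMem (by simp)]
      · rfl
    rw [h1, ih, stateAt_digRun, digPos]
    have h2 := digPos_snd_le (δ := δ) (ω := ω) k
    have h3 := hω (digPos δ ω k).1
    split_ifs with hs hlt hlt
    · simp only [add_assoc]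
    · have := h3.cost_eq δ hs
      simp only [pref_succ, digCount_append_singleton]
      omega
    · obtain ⟨α, hα⟩ := h3.eq_inl hs
      simp [hα] at hlt
    · obtain ⟨α, hα⟩ := h3.eq_inl hs
      simp only [hα, Stamp.units_inl] at h2
      simp only [pref_succ, digCount_append_singleton, hα, Stamp.cost_inl]
      omega

lemma exists_stateAt_digRun_iff (hω : ∀ n, M.Fits (stateAt M.init ω n) (ω n).1)
    (J : Set ℕ) (G : Set S) :
    (∃ k, stateAt M.init (M.digRun δ ω) k ∈ G ∧ M.numDS (M.digRun δ ω) k ∈ J) ↔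
      ∃ n, stateAt M.init ω n ∈ G ∧ ∃ j ≤ (ω n).1.units δ, digCount δ (pref ω n) + j ∈ J := by
  constructor
  · rintro ⟨k, hG, hJ⟩
    rw [stateAt_digRun] at hG
    rw [M.numDS_digRun hω] at hJ
    exact ⟨_, hG, _, digPos_snd_le k, hJ⟩
  · rintro ⟨n, hG, j, hj, hJ⟩
    obtain ⟨k, hk⟩ := exists_digPos n j hj
    refine ⟨k, ?_, ?_⟩
    · rwa [stateAt_digRun, hk]
    · rwa [M.numDS_digRun hω, hk]

end Pathwise

end MarkovAutomaton

/-! ### Exponential sojourns in units of length δ -/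

section Exponential

lemma expMeasure_eq (r : ℝ) : expMeasure r = volume.withDensity (exponentialPDF r) := rfl

lemma expMeasure_Ici {r : ℝ} (hr : 0 < r) {a : ℝ} (ha : 0 ≤ a) :
    expMeasure r (Set.Ici a) = ENNReal.ofReal (Real.exp (-(r * a))) := by
  have := isProbabilityMeasure_expMeasure hr
  have h1 : expMeasure r (Set.Iic a) = ENNReal.ofReal (1 - Real.exp (-(r * a))) := by
    rw [expMeasure_eq, withDensity_apply _ measurableSet_Iic,
      lintegral_exponentialPDF_eq_antiDeriv hr, if_pos ha]
  have h2 : NullSingletonClass (expMeasure r) :=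
    ⟨fun x => withDensity_absolutelyContinuous _ _ (measure_singleton x)⟩
  rw [← Set.compl_Iio, prob_compl_eq_one_sub measurableSet_Iio, measure_congr Iio_ae_eq_Iic, h1,
    ← ENNReal.ofReal_one, ← ENNReal.ofReal_sub _ (sub_nonneg.2 (Real.exp_le_one_iff.2
      (neg_nonpos.2 (by positivity))))]
  simp

/-- The number of full units is geometric, each further unit being survived with probability
e^{-rδ}. The case `j = 0` is separate because the set then contains the negative reals too. -/
lemma expMeasure_le_floor {r δ : ℝ} (hr : 0 < r) (hδ : 0 < δ) (j : ℕ) :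
    expMeasure r {t | j ≤ ⌊(t.toNNReal : ℝ) / δ⌋₊} =
      ENNReal.ofReal (Real.exp (-(r * δ))) ^ j := by
  have := isProbabilityMeasure_expMeasure hr
  rcases j.eq_zero_or_pos with rfl | hj
  · simp
  · have : {t : ℝ | j ≤ ⌊(t.toNNReal : ℝ) / δ⌋₊} = Set.Ici (j * δ) := by
      ext t
      have hp : (0 : ℝ) < j * δ := by positivity
      simp only [Set.mem_ofPred_eq, Nat.le_floor_iff' hj.ne', Set.mem_Ici,
        le_div_iff₀ hδ, Real.coe_toNNReal', le_max_iff]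
      exact ⟨fun h => h.resolve_right (not_le.2 hp), Or.inl⟩
    rw [this, expMeasure_Ici hr (by positivity), ← ENNReal.ofReal_pow (Real.exp_pos _).le,
      ← Real.exp_nat_mul]
    congr 2
    ring

lemma expMeasure_floor_eq {r δ : ℝ} (hr : 0 < r) (hδ : 0 < δ) (j : ℕ) :
    expMeasure r {t | ⌊(t.toNNReal : ℝ) / δ⌋₊ = j} =
      ENNReal.ofReal (Real.exp (-(r * δ))) ^ j *
        ENNReal.ofReal (1 - Real.exp (-(r * δ))) := by
  have := isProbabilityMeasure_expMeasure hr
  have hm : Measurable fun t : ℝ => ⌊(t.toNNReal : ℝ) / δ⌋₊ :=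
    Nat.measurable_floor.comp
      ((measurable_coe_nnreal_real.comp measurable_real_toNNReal).div_const δ)
  have h : {t : ℝ | ⌊(t.toNNReal : ℝ) / δ⌋₊ = j} =
      {t | j ≤ ⌊(t.toNNReal : ℝ) / δ⌋₊} \
        {t | j + 1 ≤ ⌊(t.toNNReal : ℝ) / δ⌋₊} := by
    ext t
    simp only [Set.mem_ofPred_eq, Set.mem_sdiff]
    omega
  have hs : {t : ℝ | j + 1 ≤ ⌊(t.toNNReal : ℝ) / δ⌋₊} ⊆ {t | j ≤ ⌊(t.toNNReal : ℝ) / δ⌋₊} :=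
    fun t ht => (Nat.le_succ j).trans ht
  rw [h, measure_sdiff hs
    (hm (measurableSet_Ici (a := j + 1))).nullMeasurableSet (measure_ne_top _ _),
    expMeasure_le_floor hr hδ, expMeasure_le_floor hr hδ,
    ENNReal.ofReal_sub _ (Real.exp_pos _).le, ENNReal.mul_sub, ENNReal.ofReal_one, mul_one, pow_succ]
  intro _ _
  exact ENNReal.pow_ne_top ENNReal.ofReal_ne_top

end Exponential

lemma measurable_units {Act : Type*} [MeasurableSpace Act] (δ : ℝ) :
    Measurable fun κ : Stamp Act => κ.units δ := by
  have : Measurable fun κ : Stamp Act => κ.time :=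
    measurable_const.sumElim measurable_id
  exact Nat.measurable_floor.comp ((measurable_coe_nnreal_real.comp this).div_const δ)


/-! ### Measurability of digital data, and the one-step laws of the automaton -/

namespace MarkovAutomaton

variable {S Act : Type*} [Fintype S] [Fintype Act] (M : MarkovAutomaton S Act)
  [MeasurableSpace S] [MeasurableSingletonClass S]
  [MeasurableSpace Act] [MeasurableSingletonClass Act]

section Measurability

local instance : MeasurableSpace (List (DStep S Act)) := ⊤

local instance : DiscreteMeasurableSpace (List (DStep S Act)) := ⟨fun _ => trivial⟩

lemma measurable_act : Measurable M.act :=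
  (measurable_id.sumElim measurable_const :)

/-- Digital paths form a countable set and carry the discrete σ-algebra, so only the number of units
of each stamp needs a genuine measurability argument. -/
lemma measurable_digFrom (δ : ℝ) (n : ℕ) :
    Measurable fun z : S × (Fin n → TStep S Act) => M.digFrom δ z.1 (List.ofFn z.2) := by
  induction n with
  | zero => simp [digFrom]
  | succ n ih =>
    have h : (fun z : S × (Fin (n + 1) → TStep S Act) => M.digFrom δ z.1 (List.ofFn z.2)) =
        fun z => (fun y : ((ℕ × Act) × S × S) × List (DStep S Act) =>
          List.replicate y.1.1.1 (y.1.1.2, y.1.2.1) ++ (y.1.1.2, y.1.2.2) :: y.2)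
          ((((z.2 0).1.units δ, M.act (z.2 0).1), z.1, (z.2 0).2),
            M.digFrom δ (z.2 0).2 (List.ofFn fun i : Fin n => z.2 i.succ)) := by
      funext z
      rw [List.ofFn_succ, digFrom]
      rfl
    rw [h]
    have h0 : Measurable fun z : S × (Fin (n + 1) → TStep S Act) => z.2 0 := by fun_prop
    refine (Measurable.of_discrete (f := fun y : ((ℕ × Act) × S × S) × List (DStep S Act) =>
      List.replicate y.1.1.1 (y.1.1.2, y.1.2.1) ++ (y.1.1.2, y.1.2.2) :: y.2)).comp
      ((((((measurable_units δ).comp h0.fst).prodMk (M.measurable_act.comp h0.fst))).prodMk (measurable_fst.prodMk h0.snd)).prodMk ?_)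
    exact ih.comp (h0.snd.prodMk (by fun_prop))

/-- A property of a finite history and the next step that depends only on finitely many discrete
data is measurable. -/
lemma measurableSet_step (δ : ℝ) (n : ℕ) (B : List (DStep S Act) → S → ℕ → Act → Bool → S → Prop) :
    MeasurableSet {z : (Fin n → TStep S Act) × TStep S Act |
      B (M.digPath δ (List.ofFn z.1)) (lastState M.init (List.ofFn z.1)) (z.2.1.units δ)
        (M.act z.2.1) z.2.1.isLeft z.2.2} := by
  have h1 : Measurable fun w : Fin n → TStep S Act => M.digPath δ (List.ofFn w) :=
    (M.measurable_digFrom δ n).comp measurable_prodMk_left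
  have h2 := measurable_lastState (B := Stamp Act) M.init n
  have h3 : Measurable fun κ : Stamp Act => κ.isLeft :=
    (measurable_const.sumElim measurable_const :
      Measurable (Sum.elim (fun _ : Act => true) (fun _ : ℝ≥0 => false)))
  have h4 : Measurable fun z : (Fin n → TStep S Act) × TStep S Act => z.2.1 := by fun_prop
  have h5 : Measurable fun z : (Fin n → TStep S Act) × TStep S Act =>
      ((M.digPath δ (List.ofFn z.1), lastState M.init (List.ofFn z.1)),
        (z.2.1.units δ, M.act z.2.1), z.2.1.isLeft, z.2.2) :=
    ((h1.comp measurable_fst).prodMk (h2.comp measurable_fst)).prodMk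
      ((((measurable_units δ).comp h4).prodMk (M.measurable_act.comp h4)).prodMk
        ((h3.comp h4).prodMk measurable_snd.snd))
  exact h5 (MeasurableSet.of_discrete
    (s := {y : (List (DStep S Act) × S) × (ℕ × Act) × Bool × S |
      B y.1.1 y.1.2 y.2.1.1 y.2.1.2 y.2.2.1 y.2.2.2}))

lemma measurableSet_pref (δ : ℝ) (n : ℕ)
    (B : List (DStep S Act) → S → ℕ → Act → Bool → S → Prop) :
    MeasurableSet {ω : ℕ → TStep S Act |
      B (M.digPath δ (pref ω n)) (lastState M.init (pref ω n)) ((ω n).1.units δ)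
        (M.act (ω n).1) (ω n).1.isLeft (ω n).2} := by
  have hm : Measurable fun ω : ℕ → TStep S Act => ((fun i : Fin n => ω i), ω n) := by fun_prop
  exact hm (M.measurableSet_step δ n B)

end Measurability

section StepMeasure

variable (σ : M.Scheduler) {w : List (TStep S Act)}

lemma stepMeasure_apply_PS (h : lastState M.init w ∈ M.PS) {T : Set (TStep S Act)}
    (hT : MeasurableSet T) :
    M.stepMeasure σ w T = ∑ α, ∑ s', ENNReal.ofReal (σ.toFun w α *
      M.P (lastState M.init w) α s') * T.indicator 1 (Sum.inl α, s') := by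
  rw [stepMeasure, if_pos h]
  simp [Measure.dirac_apply' _ hT]

lemma stepMeasure_apply_MS (h : lastState M.init w ∈ M.MS) {T : Set (TStep S Act)}
    (hT : MeasurableSet T) :
    M.stepMeasure σ w T = ∑ s', ENNReal.ofReal (M.P (lastState M.init w) M.tau s') *
      expMeasure (M.exitRate (lastState M.init w)) {t | (Sum.inr t.toNNReal, s') ∈ T} := by
  rw [stepMeasure, if_neg (not_mem_PS_of_mem_MS h)]
  simp only [Measure.coe_finsetSum, Finset.sum_apply, Measure.smul_apply, smul_eq_mul]
  refine Finset.sum_congr rfl fun s' _ => ?_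
  rw [Measure.map_apply (measurable_stamp s') hT]
  rfl

/-- After every history, the next step has the type of the current state and positive
probability. -/
lemma ae_stepMeasure (w : List (TStep S Act)) : ∀ᵐ x ∂(M.stepMeasure σ w),
    M.Fits (lastState M.init w) x.1 ∧ 0 < M.P (lastState M.init w) (M.act x.1) x.2 := by
  have hT : MeasurableSet {x : TStep S Act | ¬ (M.Fits (lastState M.init w) x.1 ∧
      0 < M.P (lastState M.init w) (M.act x.1) x.2)} := by
    have hm : Measurable fun x : TStep S Act => ((Fin.elim0 : Fin 0 → TStep S Act), x) := by
      fun_prop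
    have := hm (M.measurableSet_step 1 0 fun _ _ _ α b s' => ¬ (((lastState M.init w ∈ M.PS → b) ∧
      (lastState M.init w ∈ M.MS → ¬ b)) ∧ 0 < M.P (lastState M.init w) α s'))
    convert this using 1
    ext x
    simp [Fits]
  rw [ae_iff]
  by_cases h : lastState M.init w ∈ M.PS
  · rw [stepMeasure_apply_PS M σ h hT]
    refine Finset.sum_eq_zero fun α _ => Finset.sum_eq_zero fun s' _ => ?_
    by_cases hP : 0 < M.P (lastState M.init w) α s'
    · rw [Set.indicator_of_notMem, mul_zero]
      simp [Fits, act, hP, not_mem_MS_of_mem_PS h]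
    · have : M.P (lastState M.init w) α s' = 0 := le_antisymm (not_lt.1 hP) (M.P_nonneg _ _ _)
      simp [this]
  · have hs := mem_MS_of_not_mem_PS h
    rw [stepMeasure_apply_MS M σ hs hT]
    refine Finset.sum_eq_zero fun s' _ => ?_
    by_cases hP : 0 < M.P (lastState M.init w) M.tau s'
    · have : ¬ M.P (lastState M.init w) M.tau s' ≤ 0 := not_le.2 hP
      simp [Fits, act, this, h]
    · have : M.P (lastState M.init w) M.tau s' = 0 := le_antisymm (not_lt.1 hP) (M.P_nonneg _ _ _)
      simp [this]

instance (σ : M.Scheduler) : IsProbabilityMeasure (M.prob σ) := by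
  unfold prob; infer_instance

/-- Divergence of time is non-Zenoness. The other conditions concern single steps, hold almost
surely after every history, and there are countably many steps. -/
lemma ae_mem_IPaths (hM : M.NonZeno) : ∀ᵐ ω ∂(M.prob σ), ω ∈ M.IPaths := by
  have h1 : ∀ᵐ ω ∂(M.prob σ), (∑' i, ((ω i).1.time : ℝ≥0∞)) = ∞ := hM σ
  have h2 : ∀ᵐ ω ∂(M.prob σ), ∀ n, M.Fits (lastState M.init (pref ω n)) (ω n).1 ∧
      0 < M.P (lastState M.init (pref ω n)) (M.act (ω n).1) (ω n).2 := by
    refine ae_all_iff.2 fun n => (M.stepLaw σ).ae_step n (A := fun w x =>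
      M.Fits (lastState M.init w) x.1 ∧ 0 < M.P (lastState M.init w) (M.act x.1) x.2) ?_
      (M.ae_stepMeasure σ)
    convert M.measurableSet_step 1 n fun _ s _ α b s' => (((s ∈ M.PS → b) ∧
      (s ∈ M.MS → ¬ b)) ∧ 0 < M.P s α s') using 1
    ext x
    simp [Fits]
  filter_upwards [h1, h2] with ω hω1 hω2
  refine ⟨hω1, fun i => ?_⟩
  have := hω2 i
  rw [lastState_pref] at this
  exact ⟨this.2, this.1.1, this.1.2⟩

end StepMeasure

end MarkovAutomaton

/-! ### Runs of a Markov decision process -/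

namespace MDP

variable {S Act : Type*} [Fintype S] [Fintype Act] (D : MDP S Act)
  [MeasurableSpace S] [MeasurableSingletonClass S]
  [MeasurableSpace Act] [MeasurableSingletonClass Act] (τ : D.Scheduler)

lemma stepLaw_apply_singleton (w : List (DStep S Act)) (x : DStep S Act) :
    (D.stepLaw τ).toFun w {x} =
      ENNReal.ofReal (τ.toFun w x.1 * D.P (lastState D.init w) x.1 x.2) := by
  classical
  obtain ⟨α, s'⟩ := x
  change (∑ α, ∑ s', ENNReal.ofReal (τ.toFun w α * D.P (lastState D.init w) α s') •
    Measure.dirac (α, s')) {(α, s')} = _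
  simp only [Measure.coe_finsetSum, Finset.sum_apply, Measure.smul_apply, smul_eq_mul,
    Measure.dirac_apply' _ (measurableSet_singleton _)]
  rw [Finset.sum_eq_single α, Finset.sum_eq_single s'] <;> simp +contextual

instance : IsProbabilityMeasure (D.prob τ) := by
  unfold prob; infer_instance

lemma ae_mem_IPaths : ∀ᵐ ω ∂(D.prob τ), ω ∈ D.IPaths := by
  have h2 : ∀ᵐ ω ∂(D.prob τ), ∀ n, 0 < D.P (lastState D.init (pref ω n)) (ω n).1 (ω n).2 := by
    refine ae_all_iff.2 fun n => (D.stepLaw τ).ae_step n (A := fun w x =>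
      0 < D.P (lastState D.init w) x.1 x.2) (Set.toFinite _).measurableSet fun w => ?_
    rw [ae_iff_of_countable]
    intro x hx
    rw [stepLaw_apply_singleton] at hx
    by_contra h
    have : D.P (lastState D.init w) x.1 x.2 = 0 := le_antisymm (not_lt.1 h) (D.nonneg _ _ _)
    simp [this] at hx
  filter_upwards [h2] with ω hω i
  have := hω i
  rwa [lastState_pref] at this

lemma measure_pref_append (p : List (DStep S Act)) (x : DStep S Act) :
    D.prob τ {ω | pref ω (p.length + 1) = p ++ [x]} =
      D.prob τ {ω | pref ω p.length = p} * (D.stepLaw τ).toFun p {x} := by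
  have hm : MeasurableSet {ω : ℕ → DStep S Act | pref ω p.length = p} := by
    have : Measurable fun ω : ℕ → DStep S Act => fun i : Fin p.length => ω i := by fun_prop
    exact this (Set.toFinite {v : Fin p.length → DStep S Act | List.ofFn v = p}).measurableSet
  simp_rw [pref_eq_append_iff]
  rw [prob, (D.stepLaw τ).measure_step p.length (A := fun w y => w = p ∧ y = x)
    (Set.toFinite _).measurableSet, mul_comm, ← lintegral_indicator_const hm]
  refine lintegral_congr fun ω => ?_
  by_cases h : pref ω p.length = p
  · simp [h]
  · simp [h]

end MDP

/-! ### The next digital step after a timed history -/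

namespace MarkovAutomaton

variable {S Act : Type*} [Fintype S] [Fintype Act] (M : MarkovAutomaton S Act)
  {δ : ℝ} (hδ : 0 < δ)

section Enabled

variable {M} in
lemma P_eq_zero_of_ne_tau {s : S} (hs : s ∈ M.MS) {α : Act} (hα : α ≠ M.tau) (s' : S) :
    M.P s α s' = 0 := by
  rw [P, dif_neg]
  rintro ⟨μ, h | h⟩
  · exact not_mem_MS_of_mem_PS ⟨α, μ, h⟩ hs
  · exact hα h.1

lemma dig_enabled_PS {s : S} (hs : s ∈ M.PS) : (M.dig δ hδ).enabled s = M.enabled s := by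
  ext α
  simp [MDP.enabled, enabled, dig, digP, not_mem_MS_of_mem_PS hs]

lemma eq_tau_of_mem_dig_enabled {s : S} (hs : s ∈ M.MS) {α : Act}
    (h : α ∈ (M.dig δ hδ).enabled s) : α = M.tau := by
  by_contra hα
  obtain ⟨s', hs'⟩ := h
  simp [dig, digP, hα, P_eq_zero_of_ne_tau hs hα] at hs'

/-- At a Markovian state the self-loop has weight at least e^{-E(s)δ} > 0. Needed to let a scheduler
choose something where its defining average is undefined. -/
lemma dig_enabled_nonempty (s : S) : ((M.dig δ hδ).enabled s).Nonempty := by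
  have key : ∃ α, ∑ s', (M.dig δ hδ).P s α s' = 1 := by
    by_cases h : s ∈ M.MS
    · refine ⟨M.tau, ((M.dig δ hδ).sum_mem s M.tau).resolve_left fun h0 => ?_⟩
      have := (Finset.sum_eq_zero_iff_of_nonneg fun i _ => (M.dig δ hδ).nonneg s M.tau i).1 h0 s
        (Finset.mem_univ _)
      have h1 : Real.exp (-(M.exitRate s * δ)) ≤ 1 :=
        Real.exp_le_one_iff.2 (neg_nonpos.2 (mul_pos (exitRate_pos h) hδ).le)
      have h2 := mul_nonneg (M.P_nonneg s M.tau s) (sub_nonneg.2 h1)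
      have h3 := Real.exp_pos (-(M.exitRate s * δ))
      simp only [dig, digP, h, true_and, if_true] at this
      linarith
    · have hp : s ∈ M.PS := by
        by_contra hp
        exact h (mem_MS_of_not_mem_PS hp)
      obtain ⟨α, μ, hμ⟩ := hp
      refine ⟨α, ?_⟩
      simp only [dig, digP, h, false_and, if_false]
      exact sum_P_of_moves (Or.inl hμ)
  obtain ⟨α, hα⟩ := key
  refine ⟨α, ?_⟩
  by_contra hn
  have : ∀ s', (M.dig δ hδ).P s α s' = 0 := fun s' =>
    le_antisymm (not_lt.1 fun h => hn ⟨s', h⟩) ((M.dig δ hδ).nonneg _ _ _)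
  simp [this] at hα

lemma toFun_tau (τ : (M.dig δ hδ).Scheduler) {p : List (DStep S Act)}
    (hp : lastState M.init p ∈ M.MS) : τ.toFun p M.tau = 1 := by
  rw [← (τ.isDist p).sum_one, Finset.sum_eq_single M.tau]
  · exact fun α _ hα => (τ.isDist p).support α fun h =>
      hα (M.eq_tau_of_mem_dig_enabled hδ hp h)
  · simp

end Enabled

variable [MeasurableSpace S] [MeasurableSingletonClass S]
  [MeasurableSpace Act] [MeasurableSingletonClass Act]

section Kernel

variable (σ : M.Scheduler) (w : List (TStep S Act)) (p : List (DStep S Act))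

/-- The steps after the history `w` for which the digitization passes through `p` before they are
completed. -/
def passing (δ : ℝ) : Set (TStep S Act) :=
  {y | ∃ j ≤ y.1.units δ, M.digPartial δ w y j = p}

/-- The steps after the history `w` for which the digitization passes through `p` before they are
completed, and continues with `x`. -/
def passingTo (δ : ℝ) (x : DStep S Act) : Set (TStep S Act) :=
  {y | ∃ j ≤ y.1.units δ, M.digPartial δ w y j = p ∧ M.nextDig δ (lastState M.init w) y j = x}

lemma measurableSet_passing_prod (δ : ℝ) (n : ℕ) :
    MeasurableSet {z : (Fin n → TStep S Act) × TStep S Act |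
      z.2 ∈ M.passing (List.ofFn z.1) p δ} :=
  M.measurableSet_step δ n fun q s u α _ _ => ∃ j ≤ u, q ++ List.replicate j (α, s) = p

lemma measurableSet_passingTo_prod (δ : ℝ) (x : DStep S Act) (n : ℕ) :
    MeasurableSet {z : (Fin n → TStep S Act) × TStep S Act |
      z.2 ∈ M.passingTo (List.ofFn z.1) p δ x} :=
  M.measurableSet_step δ n fun q s u α _ s' => ∃ j ≤ u, q ++ List.replicate j (α, s) = p ∧
    (α, if j < u then s else s') = x

lemma measurableSet_passing (δ : ℝ) : MeasurableSet (M.passing w p δ) := by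
  have := (measurable_prodMk_left (x := w.get)) (M.measurableSet_passing_prod p δ w.length)
  simpa [List.ofFn_get] using this

lemma measurableSet_passingTo (δ : ℝ) (x : DStep S Act) : MeasurableSet (M.passingTo w p δ x) := by
  have := (measurable_prodMk_left (x := w.get)) (M.measurableSet_passingTo_prod p δ x w.length)
  simpa [List.ofFn_get] using this

variable {w p}

lemma lastState_of_digPartial_eq {y : TStep S Act} {j : ℕ} (h : M.digPartial δ w y j = p) :
    lastState M.init w = lastState M.init p := by
  rw [← h, lastState_digPartial]

/-- In a Markovian state, the digital successor is independent of how the current digital path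
came about. -/
lemma stepMeasure_passingTo_MS (hp : lastState M.init p ∈ M.MS) (τ : (M.dig δ hδ).Scheduler)
    (x : DStep S Act) :
    M.stepMeasure σ w (M.passingTo w p δ x) =
      M.stepMeasure σ w (M.passing w p δ) * ((M.dig δ hδ).stepLaw τ).toFun p {x} := by
  -- If no number of self-loops extends the digitized history to `p`, both sides vanish. Otherwise
  -- that number is unique, since it is determined by the length of `p`.
  by_cases hj : lastState M.init w = lastState M.init p ∧
    ∃ j, M.digPath δ w ++ List.replicate j (M.tau, lastState M.init w) = p
  swap
  · by_cases hl : lastState M.init w = lastState M.init p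
    · have hw : lastState M.init w ∈ M.MS := hl ▸ hp
      have hne : ∀ j, M.digPath δ w ++ List.replicate j (M.tau, lastState M.init w) ≠ p :=
        fun j h => hj ⟨hl, j, h⟩
      rw [stepMeasure_apply_MS M σ hw (M.measurableSet_passing w p δ),
        stepMeasure_apply_MS M σ hw (M.measurableSet_passingTo w p δ x)]
      simp [passing, passingTo, digPartial, act, hne]
    · have h1 : M.passing w p δ = ∅ := Set.eq_empty_of_forall_notMem fun y ⟨j, _, h⟩ =>
        hl (M.lastState_of_digPartial_eq h)
      have h2 : M.passingTo w p δ x = ∅ := Set.eq_empty_of_forall_notMem fun y ⟨j, _, h, _⟩ =>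
        hl (M.lastState_of_digPartial_eq h)
      simp [h1, h2]
  obtain ⟨hl, j, hj⟩ := hj
  have hw : lastState M.init w ∈ M.MS := hl ▸ hp
  have hiff : ∀ i, M.digPath δ w ++ List.replicate i (M.tau, lastState M.init w) = p ↔ i = j := by
    intro i
    refine ⟨fun h => ?_, fun h => h ▸ hj⟩
    have := congrArg List.length (h.trans hj.symm)
    simpa using this
  set s := lastState M.init w with hs
  set r := M.exitRate s with hr
  have hr0 : 0 < r := exitRate_pos hw
  set e : ℝ≥0∞ := ENNReal.ofReal (Real.exp (-(r * δ))) with he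
  set f : ℝ≥0∞ := ENNReal.ofReal (1 - Real.exp (-(r * δ))) with hf
  have he1 : Real.exp (-(r * δ)) ≤ 1 :=
    Real.exp_le_one_iff.2 (neg_nonpos.2 (mul_pos hr0 hδ).le)
  have hsum : ∑ s', ENNReal.ofReal (M.P s M.tau s') = 1 := by
    rw [← ENNReal.ofReal_sum_of_nonneg fun s' _ => M.P_nonneg _ _ s', sum_P_tau hw,
      ENNReal.ofReal_one]
  have hB : M.stepMeasure σ w (M.passing w p δ) = e ^ j := by
    rw [stepMeasure_apply_MS M σ hw (M.measurableSet_passing w p δ)]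
    have : ∀ s', {t : ℝ | ((Sum.inr t.toNNReal, s') : TStep S Act) ∈ M.passing w p δ} =
        {t | j ≤ ⌊(t.toNNReal : ℝ) / δ⌋₊} := by
      intro s'
      ext t
      simp only [passing, Set.mem_ofPred_eq, digPartial, act, ← hs, hiff, exists_eq_right]
      rfl
    simp_rw [this, ← hs, ← hr, expMeasure_le_floor hr0 hδ]
    rw [← Finset.sum_mul, hsum, one_mul]
  rw [hB, stepMeasure_apply_MS M σ hw (M.measurableSet_passingTo w p δ x),
    MDP.stepLaw_apply_singleton]
  have hset : ∀ s', {t : ℝ | ((Sum.inr t.toNNReal, s') : TStep S Act) ∈ M.passingTo w p δ x} =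
        {t | j ≤ ⌊(t.toNNReal : ℝ) / δ⌋₊ ∧
          (M.tau, if j < ⌊(t.toNNReal : ℝ) / δ⌋₊ then s else s') = x} := by
    intro s'
    ext t
    simp only [passingTo, Set.mem_ofPred_eq, digPartial, act, ← hs, hiff]
    constructor
    · rintro ⟨i, h1, rfl, h2⟩
      exact ⟨h1, h2⟩
    · rintro ⟨h1, h2⟩
      exact ⟨j, h1, rfl, h2⟩
  simp_rw [hset, ← hs, ← hr]
  obtain ⟨β, s₁⟩ := x
  have hdl : lastState (M.dig δ hδ).init p = s := hl.symm
  simp only [hdl]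
  by_cases hβ : β = M.tau
  swap
  · have h1 : (M.dig δ hδ).P s β s₁ = 0 := by
      simp [dig, digP, hβ, P_eq_zero_of_ne_tau hw hβ]
    simp [h1, Ne.symm hβ]
  subst hβ
  classical
  have hm : ∀ s', expMeasure r {t | j ≤ ⌊(t.toNNReal : ℝ) / δ⌋₊ ∧
      (M.tau, if j < ⌊(t.toNNReal : ℝ) / δ⌋₊ then s else s') = (M.tau, s₁)} =
      e ^ j * ((if s = s₁ then e else 0) + if s' = s₁ then f else 0) := by
    intro s'
    -- Either the sojourn goes on for another unit, and the digital run stays in `s`, or it ends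
    -- within the current unit, and the run moves to `s'`.
    have hd : {t : ℝ | j ≤ ⌊(t.toNNReal : ℝ) / δ⌋₊ ∧
        (M.tau, if j < ⌊(t.toNNReal : ℝ) / δ⌋₊ then s else s') = (M.tau, s₁)} =
        {t : ℝ | j + 1 ≤ ⌊(t.toNNReal : ℝ) / δ⌋₊ ∧ s = s₁} ∪
          {t : ℝ | ⌊(t.toNNReal : ℝ) / δ⌋₊ = j ∧ s' = s₁} := by
      ext t
      simp only [Prod.mk.injEq, true_and, Set.mem_ofPred_eq, Set.mem_union]
      generalize ⌊(t.toNNReal : ℝ) / δ⌋₊ = u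
      rcases lt_trichotomy j u with h | h | h
      · simp [h, h.le, h.ne']
      · simp [← h]
      · simp [h.not_ge, h.not_gt, h.ne]
    have hmeas : Measurable fun t : ℝ => ⌊(t.toNNReal : ℝ) / δ⌋₊ :=
      Nat.measurable_floor.comp
        ((measurable_coe_nnreal_real.comp measurable_real_toNNReal).div_const δ)
    rw [hd, measure_union, mul_add]
    · congr 1
      · by_cases h : s = s₁
        · simp only [h, and_true, if_true]
          rw [expMeasure_le_floor hr0 hδ, pow_succ]
        · simp [h]
      · by_cases h : s' = s₁
        · simp only [h, and_true, if_true]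
          rw [expMeasure_floor_eq hr0 hδ]
        · simp [h]
    · rw [Set.disjoint_left]
      rintro t ⟨h1, _⟩ ⟨h2, _⟩
      omega
    · exact (hmeas (MeasurableSet.of_discrete (s := {j}))).inter (MeasurableSet.const _)
  simp_rw [hm]
  rw [M.toFun_tau hδ τ hp, one_mul]
  -- The two summands are the weights of these two alternatives, given that `j` units have been
  -- survived.
  have hD : ENNReal.ofReal ((M.dig δ hδ).P s M.tau s₁) =
      (if s = s₁ then e else 0) + ENNReal.ofReal (M.P s M.tau s₁) * f := by
    rw [← ENNReal.ofReal_mul (M.P_nonneg _ _ _)]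
    simp only [dig, digP, hw, true_and, if_true, ← hr]
    split_ifs
    · rw [ENNReal.ofReal_add (mul_nonneg (M.P_nonneg _ _ _) (sub_nonneg.2 he1))
        (Real.exp_pos _).le, add_comm]
    · simp
  rw [hD]
  calc ∑ s', ENNReal.ofReal (M.P s M.tau s') *
        (e ^ j * ((if s = s₁ then e else 0) + if s' = s₁ then f else 0))
      = e ^ j * ((∑ s', ENNReal.ofReal (M.P s M.tau s')) * (if s = s₁ then e else 0) +
          ∑ s', ENNReal.ofReal (M.P s M.tau s') * if s' = s₁ then f else 0) := by
        rw [Finset.sum_mul, ← Finset.sum_add_distrib, Finset.mul_sum]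
        refine Finset.sum_congr rfl fun s' _ => ?_
        ring
    _ = _ := by
        rw [hsum, one_mul]
        simp

open Classical in
/-- In a probabilistic state, the digital successor is chosen as in the automaton. -/
lemma stepMeasure_passingTo_PS (hp : lastState M.init p ∈ M.PS) (x : DStep S Act) :
    M.stepMeasure σ w (M.passingTo w p δ x) =
      (if M.digPath δ w = p then ENNReal.ofReal (σ.toFun w x.1) else 0) *
        ENNReal.ofReal (M.P (lastState M.init p) x.1 x.2) := by
  by_cases hl : lastState M.init w = lastState M.init p
  swap
  · have h2 : M.passingTo w p δ x = ∅ := Set.eq_empty_of_forall_notMem fun y ⟨j, _, h, _⟩ =>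
      hl (M.lastState_of_digPartial_eq h)
    have h3 : M.digPath δ w ≠ p := fun h => hl (by rw [← h, lastState_digPath])
    simp [h2, h3]
  · have hw : lastState M.init w ∈ M.PS := hl ▸ hp
    rw [stepMeasure_apply_PS M σ hw (M.measurableSet_passingTo w p δ x)]
    have hmem : ∀ α s', ((Sum.inl α, s') : TStep S Act) ∈ M.passingTo w p δ x ↔
        M.digPath δ w = p ∧ (α, s') = x := by
      intro α s'
      simp [passingTo, digPartial, nextDig, act]
    obtain ⟨β, s₁⟩ := x
    by_cases hq : M.digPath δ w = p
    · rw [Finset.sum_eq_single β, Finset.sum_eq_single s₁]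
      · simp [hmem, hq, Set.indicator_of_mem, hl,
          ENNReal.ofReal_mul ((σ.isDist w).nonneg β)]
      · intro s' _ h
        rw [Set.indicator_of_notMem, mul_zero]
        simp [hmem, h]
      · simp
      · intro α _ h
        refine Finset.sum_eq_zero fun s' _ => ?_
        rw [Set.indicator_of_notMem, mul_zero]
        simp [hmem, h]
      · simp
    · rw [if_neg hq, zero_mul]
      refine Finset.sum_eq_zero fun α _ => Finset.sum_eq_zero fun s' _ => ?_
      rw [Set.indicator_of_notMem, mul_zero]
      simp [hmem, hq]

end Kernel

end MarkovAutomaton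

/-! ### The law of the digitized run -/

namespace MarkovAutomaton

variable {S Act : Type*} [Fintype S] [Fintype Act] (M : MarkovAutomaton S Act)
  {δ : ℝ} (hδ : 0 < δ)

section Induced

variable {M} {ω : ℕ → TStep S Act} (hω : ω ∈ M.IPaths) {p : List (DStep S Act)}

include hω

lemma pref_mem_induced_iff (n : ℕ) : pref ω n ∈ M.induced δ p ↔ M.digPath δ (pref ω n) = p :=
  ⟨fun h => h.2, fun h => ⟨⟨ω, hω, n, rfl⟩, h⟩⟩

lemma digPath_pref_eq_iff (hp : lastState M.init p ∈ M.PS) (n : ℕ) :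
    M.digPath δ (pref ω n) = p ↔
      pref (M.digRun δ ω) p.length = p ∧ (digPos δ ω p.length).1 = n := by
  constructor
  · intro h
    obtain ⟨h1, h2⟩ := (M.pref_digRun_eq_iff (δ := δ) (ω := ω) p n 0).2
      ⟨Nat.zero_le _, by simpa [digPartial] using h⟩
    exact ⟨h1, by rw [h2]⟩
  · rintro ⟨h1, h2⟩
    obtain ⟨h3, h4⟩ := (M.pref_digRun_eq_iff (δ := δ) (ω := ω) p n (digPos δ ω p.length).2).1
      ⟨h1, by rw [← h2]⟩
    have hs : stateAt M.init ω n ∈ M.PS := by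
      rw [← lastState_pref, ← M.lastState_digPartial δ _ (ω n) (digPos δ ω p.length).2, h4]
      exact hp
    -- A probabilistic state has no self-loops pending, so `p` is the digitization of a whole prefix
    -- and not of an unfinished sojourn.
    obtain ⟨α, hα⟩ := (fits_of_mem_IPaths hω n).eq_inl (not_mem_MS_of_mem_PS hs)
    rw [hα, Stamp.units_inl, Nat.le_zero] at h3
    rw [h3] at h4
    simpa [digPartial] using h4

lemma mem_cyl_induced_iff (hp : lastState M.init p ∈ M.PS) :
    ω ∈ cyl (M.induced δ p) ↔ pref (M.digRun δ ω) p.length = p := by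
  simp only [cyl, Set.mem_ofPred_eq, pref_mem_induced_iff hω, digPath_pref_eq_iff hω hp]
  exact ⟨fun ⟨_, h, _⟩ => h, fun h => ⟨_, h, rfl⟩⟩

open Classical in
lemma choiceAlong_eq_sum [MeasurableSpace S] [MeasurableSingletonClass S]
    [MeasurableSpace Act] [MeasurableSingletonClass Act] (σ : M.Scheduler) (α : Act) :
    M.choiceAlong δ σ p α ω = ∑ n ∈ Finset.range (p.length + 1),
      if M.digPath δ (pref ω n) = p then σ.toFun (pref ω n) α else 0 := by
  simp only [choiceAlong, pref_mem_induced_iff hω]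

end Induced

variable [MeasurableSpace S] [MeasurableSingletonClass S]
  [MeasurableSpace Act] [MeasurableSingletonClass Act] (σ : M.Scheduler)

section Choice

lemma choiceAlong_nonneg (p : List (DStep S Act)) (α : Act) (ω : ℕ → TStep S Act) :
    0 ≤ M.choiceAlong δ σ p α ω := by
  refine Finset.sum_nonneg fun n _ => ?_
  split_ifs
  · exact (σ.isDist _).nonneg α
  · exact le_rfl

lemma choiceAlong_eq_zero {p : List (DStep S Act)} (α : Act) {ω : ℕ → TStep S Act}
    (h : ω ∉ cyl (M.induced δ p)) : M.choiceAlong δ σ p α ω = 0 := by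
  refine Finset.sum_eq_zero fun n _ => if_neg fun hn => h ⟨n, hn⟩

/-- Along a run in the cylinder, the choice is the one made after the induced prefix. -/
lemma exists_choiceAlong_eq {p : List (DStep S Act)} {ω : ℕ → TStep S Act}
    (h : ω ∈ cyl (M.induced δ p)) : ∃ n, lastState M.init (pref ω n) = lastState M.init p ∧
      ∀ α, M.choiceAlong δ σ p α ω = σ.toFun (pref ω n) α := by
  obtain ⟨n, hn⟩ := h
  -- The position after `p` is a function of the run, so at most one prefix is induced by `p` and
  -- the sum has one nonzero term.
  have hpos : ∀ m, pref ω m ∈ M.induced δ p → digPos δ ω p.length = (m, 0) := fun m hm =>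
    ((M.pref_digRun_eq_iff (δ := δ) (ω := ω) p m 0).2
      ⟨Nat.zero_le _, by simpa [digPartial] using hm.2⟩).2
  refine ⟨n, by rw [← hn.2, lastState_digPath], fun α => ?_⟩
  rw [choiceAlong, Finset.sum_eq_single n, if_pos hn]
  · exact fun m _ hmn => if_neg fun hm => hmn (by
      have := (hpos m hm).symm.trans (hpos n hn)
      simpa using this)
  · intro hr
    have := digPos_fst_le (δ := δ) (ω := ω) p.length
    rw [hpos n hn] at this
    exact absurd (Finset.mem_range.2 (Nat.lt_succ_of_le this)) hr

variable (hM : M.NonZeno) {p : List (DStep S Act)} (hp : lastState M.init p ∈ M.PS)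

-- Induced prefixes have to be finite paths, hence extendable to time-divergent runs; almost surely
-- this is automatic. The right-hand event is measurable and decomposes step by step.
include hM hp in
lemma cyl_induced_ae_eq :
    cyl (M.induced δ p) =ᵐ[M.prob σ] {ω | pref (M.digRun δ ω) p.length = p} := by
  filter_upwards [M.ae_mem_IPaths σ hM] with ω hω
  exact propext (mem_cyl_induced_iff hω hp)

lemma measurable_choice (n : ℕ) (α : Act) :
    Measurable fun ω : ℕ → TStep S Act => σ.toFun (pref ω n) α :=
  (σ.meas n α).comp (g := fun w : Fin n → TStep S Act => σ.toFun (List.ofFn w) α)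
    (f := fun ω : ℕ → TStep S Act => fun i : Fin n => ω i) (by fun_prop)

lemma measurableSet_digPath_pref (n : ℕ) (p : List (DStep S Act)) :
    MeasurableSet {ω : ℕ → TStep S Act | M.digPath δ (pref ω n) = p} :=
  M.measurableSet_pref δ n fun q _ _ _ _ _ => q = p

/-- The index is the number of timed steps completed by the end of `p`. It is at most the length of
`p`, as each timed step yields at least one digital step, and it is unique (`disjoint_passing`). -/
lemma pref_digRun_eq_iUnion (p : List (DStep S Act)) :
    {ω | pref (M.digRun δ ω) p.length = p} =
      ⋃ n ∈ Finset.range (p.length + 1), {ω | ω n ∈ M.passing (pref ω n) p δ} := by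
  ext ω
  simp only [Set.mem_ofPred_eq, Set.mem_iUnion, Finset.mem_range, exists_prop]
  constructor
  · intro h
    refine ⟨(digPos δ ω p.length).1, Nat.lt_succ_of_le (digPos_fst_le _), _,
      (M.pref_digRun_eq_iff p _ _).1 ⟨h, rfl⟩⟩
  · rintro ⟨n, -, j, h⟩
    exact ((M.pref_digRun_eq_iff p n j).2 h).1

lemma pref_digRun_append_eq_iUnion (p : List (DStep S Act)) (x : DStep S Act) :
    {ω | pref (M.digRun δ ω) (p.length + 1) = p ++ [x]} =
      ⋃ n ∈ Finset.range (p.length + 1), {ω | ω n ∈ M.passingTo (pref ω n) p δ x} := by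
  ext ω
  simp only [Set.mem_ofPred_eq, Set.mem_iUnion, Finset.mem_range, exists_prop, pref_eq_append_iff]
  constructor
  · rintro ⟨h, h2⟩
    obtain ⟨h3, h4⟩ := (M.pref_digRun_eq_iff (δ := δ) (ω := ω) p _ _).1 ⟨h, rfl⟩
    refine ⟨(digPos δ ω p.length).1, Nat.lt_succ_of_le (digPos_fst_le _), _, h3, h4, ?_⟩
    rw [lastState_pref, ← h2]
    rfl
  · rintro ⟨n, -, j, h1, h2, h3⟩
    obtain ⟨h4, h5⟩ := (M.pref_digRun_eq_iff (δ := δ) (ω := ω) p n j).2 ⟨h1, h2⟩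
    refine ⟨h4, ?_⟩
    rw [← h3, digRun, h5, lastState_pref]

lemma disjoint_passing (p : List (DStep S Act)) {n m : ℕ} (h : n ≠ m) :
    Disjoint {ω : ℕ → TStep S Act | ω n ∈ M.passing (pref ω n) p δ}
      {ω | ω m ∈ M.passing (pref ω m) p δ} := by
  rw [Set.disjoint_left]
  rintro ω ⟨j, h1⟩ ⟨i, h2⟩
  have h3 := ((M.pref_digRun_eq_iff p n j).2 h1).2
  have h4 := ((M.pref_digRun_eq_iff p m i).2 h2).2
  rw [h3] at h4
  exact h (congrArg Prod.fst h4)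

lemma passingTo_subset (w : List (TStep S Act)) (p : List (DStep S Act)) (x : DStep S Act) :
    M.passingTo w p δ x ⊆ M.passing w p δ := fun _ ⟨j, h1, h2, _⟩ => ⟨j, h1, h2⟩

lemma measurableSet_pref_digRun (p : List (DStep S Act)) :
    MeasurableSet {ω : ℕ → TStep S Act | pref (M.digRun δ ω) p.length = p} := by
  rw [pref_digRun_eq_iUnion]
  exact Finset.measurableSet_biUnion _ fun n _ =>
    M.measurableSet_pref δ n fun q s u α _ _ => ∃ j ≤ u, q ++ List.replicate j (α, s) = p

lemma measure_pref_digRun (p : List (DStep S Act)) :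
    M.prob σ {ω | pref (M.digRun δ ω) p.length = p} = ∑ n ∈ Finset.range (p.length + 1),
      ∫⁻ ω, M.stepMeasure σ (pref ω n) (M.passing (pref ω n) p δ) ∂(M.prob σ) := by
  rw [pref_digRun_eq_iUnion, measure_biUnion_finset]
  · exact Finset.sum_congr rfl fun n _ => (M.stepLaw σ).measure_step n
      (A := fun w y => y ∈ M.passing w p δ) (M.measurableSet_passing_prod p δ n)
  · exact fun n _ m _ h => M.disjoint_passing p h
  · exact fun n _ => M.measurableSet_pref δ n fun q s u α _ _ =>
      ∃ j ≤ u, q ++ List.replicate j (α, s) = p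

lemma measure_pref_digRun_append (p : List (DStep S Act)) (x : DStep S Act) :
    M.prob σ {ω | pref (M.digRun δ ω) (p.length + 1) = p ++ [x]} =
      ∑ n ∈ Finset.range (p.length + 1),
        ∫⁻ ω, M.stepMeasure σ (pref ω n) (M.passingTo (pref ω n) p δ x) ∂(M.prob σ) := by
  rw [pref_digRun_append_eq_iUnion, measure_biUnion_finset]
  · exact Finset.sum_congr rfl fun n _ => (M.stepLaw σ).measure_step n
      (A := fun w y => y ∈ M.passingTo w p δ x) (M.measurableSet_passingTo_prod p δ x n)
  · exact fun n _ m _ h => (M.disjoint_passing p h).mono (fun ω hω => M.passingTo_subset _ _ _ hω)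
      (fun ω hω => M.passingTo_subset _ _ _ hω)
  · exact fun n _ => M.measurableSet_pref δ n fun q s u α _ s' =>
      ∃ j ≤ u, q ++ List.replicate j (α, s) = p ∧ (α, if j < u then s else s') = x

include hM in
lemma integrable_choiceAlong (p : List (DStep S Act)) (α : Act) :
    Integrable (M.choiceAlong δ σ p α) (M.prob σ) := by
  classical
  have h : M.choiceAlong δ σ p α =ᵐ[M.prob σ] fun ω => ∑ n ∈ Finset.range (p.length + 1),
      if M.digPath δ (pref ω n) = p then σ.toFun (pref ω n) α else 0 := by
    filter_upwards [M.ae_mem_IPaths σ hM] with ω hω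
    rw [choiceAlong_eq_sum hω]
  refine (integrable_congr h).2 (integrable_finsetSum _ fun n _ => ?_)
  refine Integrable.of_bound (C := 1) (Measurable.aestronglyMeasurable
    (Measurable.ite (M.measurableSet_digPath_pref n p) (M.measurable_choice σ n α)
      measurable_const)) (Filter.Eventually.of_forall fun ω => ?_)
  have h0 := (σ.isDist (pref ω n)).nonneg α
  have h1 : σ.toFun (pref ω n) α ≤ 1 := by
    rw [← (σ.isDist (pref ω n)).sum_one]
    exact Finset.single_le_sum (fun i _ => (σ.isDist (pref ω n)).nonneg i) (Finset.mem_univ α)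
  split_ifs
  · rwa [Real.norm_of_nonneg h0]
  · simp

-- The choice vanishes off the cylinder, so restricting to it changes nothing and conditioning is
-- mere normalization.
include hM in
lemma integral_choiceAlong_cond (p : List (DStep S Act)) (α : Act) :
    ∫ ω, M.choiceAlong δ σ p α ω ∂((M.prob σ)[|cyl (M.induced δ p)]) =
      ((M.prob σ (cyl (M.induced δ p)))⁻¹).toReal *
        ∫ ω, M.choiceAlong δ σ p α ω ∂(M.prob σ) := by
  rw [ProbabilityTheory.cond, integral_smul_measure, smul_eq_mul,
    setIntegral_eq_integral_of_forall_compl_eq_zero fun ω hω => M.choiceAlong_eq_zero σ α hω]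

open Classical in
include hM hp in
/-- The defining equation of digitizations, without conditioning. -/
lemma IsDigitization.mul_measure {τ : (M.dig δ hδ).Scheduler}
    (hτ : M.IsDigitization δ hδ σ τ) (hpF : p ∈ (M.dig δ hδ).FPaths)
    (h0 : M.prob σ {ω | pref (M.digRun δ ω) p.length = p} ≠ 0) (α : Act) :
    ENNReal.ofReal (τ.toFun p α) * M.prob σ {ω | pref (M.digRun δ ω) p.length = p} =
      ∑ n ∈ Finset.range (p.length + 1), ∫⁻ ω, (if M.digPath δ (pref ω n) = p then
        ENNReal.ofReal (σ.toFun (pref ω n) α) else 0) ∂(M.prob σ) := by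
  have hcyl := measure_congr (M.cyl_induced_ae_eq σ hM hp (δ := δ))
  rw [← hcyl] at h0 ⊢
  rw [hτ p hpF hp h0 α, M.integral_choiceAlong_cond σ hM,
    ENNReal.ofReal_mul ENNReal.toReal_nonneg,
    ENNReal.ofReal_toReal (ENNReal.inv_ne_top.2 h0), mul_right_comm,
    ENNReal.inv_mul_cancel h0 (measure_ne_top _ _), one_mul,
    ofReal_integral_eq_lintegral_ofReal (M.integrable_choiceAlong σ hM p α)
      (Filter.Eventually.of_forall fun ω => M.choiceAlong_nonneg σ p α ω),
    ← lintegral_finsetSum]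
  · refine lintegral_congr_ae ?_
    filter_upwards [M.ae_mem_IPaths σ hM] with ω hω
    rw [choiceAlong_eq_sum hω, ENNReal.ofReal_sum_of_nonneg]
    · refine Finset.sum_congr rfl fun n _ => ?_
      split_ifs <;> simp
    · intro n _
      split_ifs
      · exact (σ.isDist _).nonneg α
      · exact le_rfl
  · exact fun n _ => Measurable.ite (M.measurableSet_digPath_pref n p)
      (M.measurable_choice σ n α).ennreal_ofReal measurable_const

end Choice

section Law

variable (hM : M.NonZeno) {τ : (M.dig δ hδ).Scheduler} (hτ : M.IsDigitization δ hδ σ τ)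

include hM hτ in
/-- The digitization of the random timed run has the law of the run of the digitized automaton. -/
theorem measure_digRun_cyl (p : List (DStep S Act)) :
    M.prob σ {ω | pref (M.digRun δ ω) p.length = p} =
      (M.dig δ hδ).prob τ {ω | pref ω p.length = p} := by
  induction p using List.reverseRecOn with
  | nil => simp
  | append_singleton p x ih =>
    rw [List.length_append, List.length_singleton, MDP.measure_pref_append, ← ih]
    -- On a null path the digitized scheduler is unconstrained, but extensions of the path are null
    -- as well.
    by_cases h0 : M.prob σ {ω | pref (M.digRun δ ω) p.length = p} = 0
    · rw [h0, zero_mul]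
      refine measure_mono_null (fun ω hω => ?_) h0
      exact (pref_eq_append_iff.1 hω).1
    · by_cases hp : lastState M.init p ∈ M.PS
      · have hpF : p ∈ (M.dig δ hδ).FPaths := by
          rw [ih] at h0
          obtain ⟨ω, hω, hω'⟩ := (frequently_ae_mem_iff.2 h0).and_eventually
            ((M.dig δ hδ).ae_mem_IPaths τ) |>.exists
          exact ⟨ω, hω', _, hω.symm⟩
        classical
        rw [measure_pref_digRun_append, MDP.stepLaw_apply_singleton,
          ENNReal.ofReal_mul ((τ.isDist p).nonneg _), ← mul_assoc, mul_comm (M.prob σ _),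
          hτ.mul_measure M hδ σ hM hp hpF h0, Finset.sum_mul]
        refine Finset.sum_congr rfl fun n _ => ?_
        have hP : (M.dig δ hδ).P (lastState (M.dig δ hδ).init p) x.1 x.2 =
            M.P (lastState M.init p) x.1 x.2 := by
          simp [dig, digP, not_mem_MS_of_mem_PS hp]
        rw [hP, ← lintegral_mul_const']
        · simp_rw [M.stepMeasure_passingTo_PS σ hp x]
        · exact ENNReal.ofReal_ne_top
      · have hp' := mem_MS_of_not_mem_PS hp
        rw [measure_pref_digRun_append, measure_pref_digRun, Finset.sum_mul]
        refine Finset.sum_congr rfl fun n _ => ?_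
        rw [← lintegral_mul_const']
        · simp_rw [M.stepMeasure_passingTo_MS hδ σ hp' τ x]
        · have := ((M.dig δ hδ).stepLaw τ).isProb p
          exact measure_ne_top _ _

end Law

end MarkovAutomaton

/-! ### The probability of an overrun -/

section Exponential

/-- One sojourn of rate `r ≤ L` does not decrease the potential `(1 + L * δ) ^ j * exp (-(L * R))`,
where `R` is the remaining time and `j` the number of remaining digitization steps. -/
lemma le_lintegral_expMeasure {r δ L R : ℝ} {j : ℕ} (hr : 0 < r) (hrL : r ≤ L) (hδ : 0 < δ)
    (hR : j * δ ≤ R) {h : ℝ → ℝ≥0∞} (hm : Measurable h) (h1 : ∀ t, R < t → 1 ≤ h t)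
    (h2 : ∀ t, 0 ≤ t → ⌊t / δ⌋₊ < j → t ≤ R →
      ENNReal.ofReal ((1 + L * δ) ^ (j - 1 - ⌊t / δ⌋₊) * Real.exp (-(L * (R - t)))) ≤ h t) :
    ENNReal.ofReal ((1 + L * δ) ^ j * Real.exp (-(L * R))) ≤ ∫⁻ t, h t ∂(expMeasure r) := by
  have hL : 0 < L := hr.trans_le hrL
  have hR0 : 0 ≤ R := le_trans (by positivity) hR
  set b := 1 + L * δ with hb
  set a := Real.exp ((L - r) * δ) with ha
  have hb0 : 0 < b := by positivity
  have ha0 : 0 < a := Real.exp_pos _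
  let c : ℕ → ℝ := fun m => r * Real.exp (-(L * R)) * (a ^ m * b ^ (j - 1 - m))
  have hc : ∀ m, 0 ≤ c m := fun m => by positivity
  have hmem : ∀ t, 0 ≤ t → ∀ m : ℕ, t ∈ Set.Ico (m * δ) ((m + 1) * δ) ↔ ⌊t / δ⌋₊ = m := by
    intro t ht m
    rw [Nat.floor_eq_iff (by positivity), le_div_iff₀ hδ, div_lt_iff₀ hδ, Set.mem_Ico]
  -- The integrand is bounded below by a constant on each of the first `j` units and by the density
  -- beyond `R`. Sojourns in [jδ, R] use up too many steps and contribute nothing to the bound.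
  have key : ∀ t, (∑ m ∈ Finset.range j, (Set.Ico ((m : ℝ) * δ) ((m + 1) * δ)).indicator
      (fun _ => ENNReal.ofReal (c m)) t) + (Set.Ioi R).indicator (exponentialPDF r) t ≤
      exponentialPDF r t * h t := by
    intro t
    rcases lt_or_ge t 0 with ht | ht
    · rw [Set.indicator_of_notMem (show t ∉ Set.Ioi R from fun h => (hR0.trans_lt h).not_gt ht),
        add_zero,
        Finset.sum_eq_zero]
      · exact zero_le
      · intro m _
        exact Set.indicator_of_notMem
          (fun h => (lt_of_le_of_lt (le_trans (by positivity) h.1) ht).false) _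
    rcases lt_or_ge R t with hRt | hRt
    · rw [Set.indicator_of_mem (Set.mem_Ioi.2 hRt), Finset.sum_eq_zero, zero_add]
      · exact le_mul_of_one_le_right' (h1 t hRt)
      · intro m hmj
        refine Set.indicator_of_notMem (fun h => ?_) _
        have h3 : ((m : ℝ) + 1) * δ ≤ j * δ := by
          have : m + 1 ≤ j := Finset.mem_range.1 hmj
          have : (m : ℝ) + 1 ≤ j := by exact_mod_cast this
          gcongr
        linarith [h.2]
    · rw [Set.indicator_of_notMem (by simpa using hRt), add_zero]
      by_cases hj : ⌊t / δ⌋₊ < j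
      · rw [Finset.sum_eq_single_of_mem _ (Finset.mem_range.2 hj),
          Set.indicator_of_mem ((hmem t ht _).2 rfl)]
        · refine le_trans ?_ (mul_le_mul_right (h2 t ht hj hRt) _)
          rw [exponentialPDF_of_nonneg ht, ← ENNReal.ofReal_mul (by positivity)]
          refine ENNReal.ofReal_le_ofReal ?_
          have h3 := ((hmem t ht _).2 rfl).1
          -- As r ≤ L, the factor e^{(L-r)t} left over from density and potential is smallest at the
          -- beginning of the unit.
          have h4 : a ^ ⌊t / δ⌋₊ ≤ Real.exp ((L - r) * t) := by
            rw [ha, ← Real.exp_nat_mul]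
            refine Real.exp_le_exp.2 ?_
            have := mul_le_mul_of_nonneg_left h3 (sub_nonneg.2 hrL)
            linarith
          have h5 : Real.exp (-(r * t)) * Real.exp (-(L * (R - t))) =
              Real.exp (-(L * R)) * Real.exp ((L - r) * t) := by
            rw [← Real.exp_add, ← Real.exp_add]
            congr 1
            ring
          calc c ⌊t / δ⌋₊ ≤ r * Real.exp (-(L * R)) *
                (Real.exp ((L - r) * t) * b ^ (j - 1 - ⌊t / δ⌋₊)) := by
                change r * Real.exp (-(L * R)) * (a ^ ⌊t / δ⌋₊ * b ^ (j - 1 - ⌊t / δ⌋₊)) ≤ _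
                gcongr
            _ = r * (Real.exp (-(L * R)) * Real.exp ((L - r) * t)) *
                  b ^ (j - 1 - ⌊t / δ⌋₊) := by ring
            _ = _ := by rw [← h5]; ring
        · intro m _ hne
          exact Set.indicator_of_notMem (fun h => hne ((hmem t ht m).1 h).symm) _
      · rw [Finset.sum_eq_zero]
        · exact zero_le
        · intro m hmj
          refine Set.indicator_of_notMem (fun h => hj ?_) _
          rw [(hmem t ht m).1 h]
          exact Finset.mem_range.1 hmj
  have hpdf : Measurable (exponentialPDF r) := (measurable_exponentialPDFReal r).ennreal_ofReal
  have hint : ∫⁻ t, ((∑ m ∈ Finset.range j, (Set.Ico ((m : ℝ) * δ) ((m + 1) * δ)).indicator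
      (fun _ => ENNReal.ofReal (c m)) t) + (Set.Ioi R).indicator (exponentialPDF r) t) =
      ENNReal.ofReal ((∑ m ∈ Finset.range j, c m * δ) + Real.exp (-(r * R))) := by
    have hlast : ∫⁻ t, (Set.Ioi R).indicator (exponentialPDF r) t =
        ENNReal.ofReal (Real.exp (-(r * R))) := by
      have h2 : NullSingletonClass (expMeasure r) :=
        ⟨fun x => withDensity_absolutelyContinuous _ _ (measure_singleton x)⟩
      rw [lintegral_indicator measurableSet_Ioi, ← withDensity_apply _ measurableSet_Ioi,
        ← expMeasure_eq, measure_congr Ioi_ae_eq_Ici, expMeasure_Ici hr hR0]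
    rw [lintegral_add_right _ (hpdf.indicator measurableSet_Ioi), hlast,
      lintegral_finsetSum _ fun m _ => measurable_const.indicator measurableSet_Ico,
      ENNReal.ofReal_add (Finset.sum_nonneg fun m _ => mul_nonneg (hc m) hδ.le)
        (Real.exp_pos _).le, ENNReal.ofReal_sum_of_nonneg fun m _ => mul_nonneg (hc m) hδ.le]
    congr 1
    refine Finset.sum_congr rfl fun m _ => ?_
    rw [lintegral_indicator_const measurableSet_Ico, Real.volume_Ico, ENNReal.ofReal_mul (hc m)]
    congr 2
    ring
  calc ENNReal.ofReal (b ^ j * Real.exp (-(L * R)))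
      ≤ ENNReal.ofReal ((∑ m ∈ Finset.range j, c m * δ) + Real.exp (-(r * R))) := by
        refine ENNReal.ofReal_le_ofReal ?_
        -- The units contribute rδ ∑ a^m b^(j-1-m), up to the factor e^{-LR}. This is at least b^j -
        -- a^j because b - a ≤ rδ, and the tail beyond `R` supplies the missing a^j because jδ ≤ R.
        have hgeom := geom_sum₂_mul a b j
        have hS : 0 ≤ ∑ m ∈ Finset.range j, a ^ m * b ^ (j - 1 - m) :=
          Finset.sum_nonneg fun m _ => by positivity
        have hab : b - a ≤ r * δ := by
          have := Real.add_one_le_exp ((L - r) * δ)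
          rw [hb]
          linarith
        have h3 : b ^ j ≤ a ^ j + r * δ * ∑ m ∈ Finset.range j, a ^ m * b ^ (j - 1 - m) := by
          have := mul_le_mul_of_nonneg_left hab hS
          linarith
        have h4 : a ^ j * Real.exp (-(L * R)) ≤ Real.exp (-(r * R)) := by
          rw [ha, ← Real.exp_nat_mul, ← Real.exp_add]
          refine Real.exp_le_exp.2 ?_
          have := mul_le_mul_of_nonneg_left hR (sub_nonneg.2 hrL)
          linarith
        have h5 : ∑ m ∈ Finset.range j, c m * δ = r * δ *
            (∑ m ∈ Finset.range j, a ^ m * b ^ (j - 1 - m)) * Real.exp (-(L * R)) := by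
          rw [Finset.mul_sum, Finset.sum_mul]
          exact Finset.sum_congr rfl fun m _ => by ring
        rw [h5]
        have := mul_le_mul_of_nonneg_right h3 (Real.exp_pos (-(L * R))).le
        linarith
    _ ≤ ∫⁻ t, exponentialPDF r t * h t := by
        rw [← hint]
        exact lintegral_mono key
    _ = ∫⁻ t, h t ∂(expMeasure r) := by
        rw [expMeasure_eq, lintegral_withDensity_eq_lintegral_mul _ hpdf hm]
        rfl

end Exponential

section Overrun

variable {S Act : Type*}

lemma prefix_append_singleton_iff {X : Type*} {l w : List X} {x : X} :
    l <+: w ++ [x] ↔ l = w ++ [x] ∨ l <+: w := by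
  rw [List.prefix_concat_iff]

/-- No prefix of the run takes more than `k` digitization steps within time `b`. -/
def NoOverrun (δ b : ℝ) (k : ℕ) (w : List (TStep S Act)) : Prop :=
  ∀ l, l <+: w → ¬ (elapsed l ≤ b ∧ k < digCount δ l)

lemma noOverrun_append_singleton {δ b : ℝ} {k : ℕ} {w : List (TStep S Act)} {x : TStep S Act} :
    NoOverrun δ b k (w ++ [x]) ↔ NoOverrun δ b k w ∧
      ¬ (elapsed (w ++ [x]) ≤ b ∧ k < digCount δ (w ++ [x])) := by
  simp only [NoOverrun, prefix_append_singleton_iff]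
  exact ⟨fun h => ⟨fun l hl => h l (Or.inr hl), h _ (Or.inl rfl)⟩,
    fun h l hl => hl.elim (fun e => e ▸ h.2) (h.1 l)⟩

open Classical in
/-- A lower bound for the probability that no overrun occurs, given the history `w`. -/
def potential (L δ b : ℝ) (k : ℕ) (w : List (TStep S Act)) : ℝ≥0∞ :=
  if NoOverrun δ b k w then
    if b < elapsed w then 1
    else ENNReal.ofReal ((1 + L * δ) ^ (k - digCount δ w) * Real.exp (-(L * (b - elapsed w))))
  else 0

-- With d steps taken, 1+x ≤ e^x bounds the power by e^{(k-d)Lδ}, and the time left is at least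
-- (k-d)δ by `elapsed_le_digCount`.
open Classical in
lemma potential_le {L δ : ℝ} (hL : 0 ≤ L) (hδ : 0 < δ) (k : ℕ) (w : List (TStep S Act)) :
    potential L δ (k * δ) k w ≤ if NoOverrun δ (k * δ) k w then 1 else 0 := by
  rw [potential]
  split_ifs with h h1
  · exact le_rfl
  · rw [ENNReal.ofReal_le_one]
    have h2 : digCount δ w ≤ k := not_lt.1 fun h2 => h w List.prefix_rfl ⟨not_lt.1 h1, h2⟩
    have h3 := elapsed_le_digCount hδ w
    have h4 : (1 + L * δ) ^ (k - digCount δ w) ≤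
        Real.exp (((k - digCount δ w : ℕ) : ℝ) * (L * δ)) := by
      rw [Real.exp_nat_mul]
      gcongr
      linarith [Real.add_one_le_exp (L * δ)]
    have h5 := mul_le_mul_of_nonneg_left h3 hL
    calc _ ≤ Real.exp (((k - digCount δ w : ℕ) : ℝ) * (L * δ)) *
          Real.exp (-(L * (k * δ - elapsed w))) := by gcongr
      _ ≤ 1 := by
        rw [← Real.exp_add, Real.exp_le_one_iff, Nat.cast_sub h2]
        linarith
  · exact le_rfl

variable [MeasurableSpace S] [MeasurableSpace Act]

lemma measurable_time : Measurable fun κ : Stamp Act => (κ.time : ℝ) := by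
  have : Measurable fun κ : Stamp Act => κ.time := measurable_const.sumElim measurable_id
  exact measurable_coe_nnreal_real.comp this

lemma measurable_cost (δ : ℝ) : Measurable fun κ : Stamp Act => κ.cost δ :=
  measurable_const.sumElim
    ((Nat.measurable_floor.comp (measurable_coe_nnreal_real.div_const δ)).add_const 1)

lemma measurable_elapsed (n : ℕ) :
    Measurable fun w : Fin n → TStep S Act => elapsed (List.ofFn w) := by
  simp only [elapsed, List.map_ofFn, List.sum_ofFn]
  exact Finset.measurable_sum _ fun i _ =>
    measurable_time.comp (measurable_pi_apply i).fst

lemma measurable_digCount (δ : ℝ) (n : ℕ) :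
    Measurable fun w : Fin n → TStep S Act => digCount δ (List.ofFn w) := by
  simp only [digCount, List.map_ofFn, List.sum_ofFn]
  exact Finset.measurable_sum _ fun i _ =>
    (measurable_cost δ).comp (measurable_pi_apply i).fst

lemma measurableSet_overrun (δ b : ℝ) (k n : ℕ) : MeasurableSet
    {w : Fin n → TStep S Act | elapsed (List.ofFn w) ≤ b ∧ k < digCount δ (List.ofFn w)} :=
  ((measurable_elapsed n) measurableSet_Iic).inter
    ((measurable_digCount δ n) (measurableSet_Ioi (a := k)))

lemma measurableSet_noOverrun (δ b : ℝ) (k n : ℕ) :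
    MeasurableSet {w : Fin n → TStep S Act | NoOverrun δ b k (List.ofFn w)} := by
  induction n with
  | zero => exact (Set.subsingleton_of_subsingleton).measurableSet
  | succ n ih =>
    have h : {w : Fin (n + 1) → TStep S Act | NoOverrun δ b k (List.ofFn w)} =
        (fun (w : Fin (n + 1) → TStep S Act) (i : Fin n) => w i.castSucc) ⁻¹'
          {w | NoOverrun δ b k (List.ofFn w)} ∩
        {w | elapsed (List.ofFn w) ≤ b ∧ k < digCount δ (List.ofFn w)}ᶜ := by
      ext w
      have : List.ofFn w = List.ofFn (fun i : Fin n => w i.castSucc) ++ [w (Fin.last n)] := by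
        rw [List.ofFn_succ', List.concat_eq_append]
      simp only [Set.mem_ofPred_eq, Set.mem_inter_iff, Set.mem_preimage, Set.mem_compl_iff]
      rw [this, noOverrun_append_singleton]
    rw [h]
    exact ((by fun_prop : Measurable _) ih).inter (measurableSet_overrun δ b k _).compl

lemma measurable_potential (L δ b : ℝ) (k n : ℕ) :
    Measurable fun w : Fin n → TStep S Act => potential L δ b k (List.ofFn w) := by
  have h1 := measurable_elapsed (S := S) (Act := Act) n
  have h2 := measurable_digCount (S := S) (Act := Act) δ n
  refine Measurable.ite (measurableSet_noOverrun δ b k n)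
    (Measurable.ite (h1 measurableSet_Ioi) measurable_const ?_) measurable_const
  refine (Measurable.mul ?_ ?_).ennreal_ofReal
  · exact (Measurable.of_discrete (f := fun d : ℕ => (1 + L * δ) ^ (k - d))).comp h2
  · fun_prop

lemma measurable_potential_append (L δ b : ℝ) (k n : ℕ) :
    Measurable fun z : (Fin n → TStep S Act) × TStep S Act =>
      potential L δ b k (List.ofFn z.1 ++ [z.2]) := by
  have h : (fun z : (Fin n → TStep S Act) × TStep S Act =>
      potential L δ b k (List.ofFn z.1 ++ [z.2])) =
      (fun w : Fin (n + 1) → TStep S Act => potential L δ b k (List.ofFn w)) ∘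
        fun z => (Fin.snoc z.1 z.2 : Fin (n + 1) → TStep S Act) := by
    funext z
    simp only [Function.comp_apply, List.ofFn_succ' (f := Fin.snoc z.1 z.2),
      List.concat_eq_append, Fin.snoc_castSucc, Fin.snoc_last]
  rw [h]
  refine (measurable_potential L δ b k (n + 1)).comp (measurable_pi_lambda _ fun i => ?_)
  induction i using Fin.lastCases with
  | last => simpa using measurable_snd
  | cast i =>
    simp only [Fin.snoc_castSucc]
    exact (measurable_pi_apply i).comp measurable_fst

end Overrun

namespace MarkovAutomaton

variable {S Act : Type*} [Fintype S] [Fintype Act] (M : MarkovAutomaton S Act)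
  {δ : ℝ} (hδ : 0 < δ)

lemma exitRate_le_rateMax {s : S} (hs : s ∈ M.MS) : M.exitRate s ≤ M.rateMax :=
  le_csSup (Set.toFinite _).bddAbove ⟨s, hs, rfl⟩

lemma rateMax_nonneg : 0 ≤ M.rateMax :=
  Real.sSup_nonneg fun _ ⟨_, hs, h⟩ => h ▸ (exitRate_pos hs).le

variable [MeasurableSpace S] [MeasurableSingletonClass S]
  [MeasurableSpace Act] [MeasurableSingletonClass Act] (σ : M.Scheduler)

lemma lintegral_stepMeasure_MS {w : List (TStep S Act)} (h : lastState M.init w ∈ M.MS)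
    {g : TStep S Act → ℝ≥0∞} (hg : Measurable g) :
    ∫⁻ y, g y ∂(M.stepMeasure σ w) = ∑ s', ENNReal.ofReal (M.P (lastState M.init w) M.tau s') *
      ∫⁻ t, g (Sum.inr t.toNNReal, s') ∂(expMeasure (M.exitRate (lastState M.init w))) := by
  rw [stepMeasure, if_neg (not_mem_PS_of_mem_MS h), lintegral_finsetSum_measure]
  refine Finset.sum_congr rfl fun s' _ => ?_
  rw [lintegral_smul_measure, smul_eq_mul, lintegral_map hg (measurable_stamp s')]

include hδ in
/-- The potential is a submartingale. -/
lemma potential_le_lintegral (k : ℕ) (w : List (TStep S Act)) :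
    potential M.rateMax δ (k * δ) k w ≤
      ∫⁻ y, potential M.rateMax δ (k * δ) k (w ++ [y]) ∂(M.stepMeasure σ w) := by
  have := (M.stepLaw σ).isProb w
  have : IsProbabilityMeasure (M.stepMeasure σ w) := this
  by_cases hn : NoOverrun δ (k * δ) k w
  swap
  · simp [potential, hn]
  by_cases hT : k * δ < elapsed w
  -- Once the time bound is exceeded no further overrun is possible, and the potential stays at 1.
  · have : ∀ y, potential M.rateMax δ (k * δ) k (w ++ [y]) = 1 := by
      intro y
      have h1 : k * δ < elapsed (w ++ [y]) := by
        rw [elapsed_append_singleton]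
        have : (0 : ℝ) ≤ y.1.time := NNReal.coe_nonneg _
        linarith
      rw [potential, if_pos (noOverrun_append_singleton.2 ⟨hn, fun h => h1.not_ge h.1⟩), if_pos h1]
    rw [lintegral_congr this]
    simp [potential, hn, hT]
  have hd : digCount δ w ≤ k := not_lt.1 fun h2 => hn w List.prefix_rfl ⟨not_lt.1 hT, h2⟩
  by_cases hs : lastState M.init w ∈ M.MS
  swap
  · have h1 : ∀ᵐ y ∂(M.stepMeasure σ w), potential M.rateMax δ (k * δ) k (w ++ [y]) =
        potential M.rateMax δ (k * δ) k w := by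
      filter_upwards [M.ae_stepMeasure σ w] with y hy
      obtain ⟨α, hα⟩ := hy.1.eq_inl hs
      have e1 : elapsed (w ++ [y]) = elapsed w := by
        rw [elapsed_append_singleton, hα]
        simp [Stamp.time]
      have e2 : digCount δ (w ++ [y]) = digCount δ w := by
        rw [digCount_append_singleton, hα]
        simp
      have e3 : NoOverrun δ (k * δ) k (w ++ [y]) :=
        noOverrun_append_singleton.2 ⟨hn, by rw [e1, e2]; exact hn w List.prefix_rfl⟩
      rw [potential, potential, if_pos hn, if_pos e3, e1, e2]
    rw [lintegral_congr_ae h1]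
    simp
  · have hm : Measurable fun y => potential M.rateMax δ (k * δ) k (w ++ [y]) := by
      have := (measurable_potential_append M.rateMax δ (k * δ) k w.length).comp
        (measurable_prodMk_left (x := w.get))
      simpa [Function.comp_def, List.ofFn_get] using this
    rw [lintegral_stepMeasure_MS M σ hs hm]
    have hsum : ∑ s', ENNReal.ofReal (M.P (lastState M.init w) M.tau s') = 1 := by
      rw [← ENNReal.ofReal_sum_of_nonneg fun s' _ => M.P_nonneg _ _ s', sum_P_tau hs,
        ENNReal.ofReal_one]
    -- Spreading the left side over the successors, of total weight one, reduces the claim to one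
    -- exponential sojourn for each successor.
    rw [← one_mul (potential M.rateMax δ (k * δ) k w), ← hsum, Finset.sum_mul]
    refine Finset.sum_le_sum fun s' _ => mul_le_mul_right ?_ _
    rw [potential, if_pos hn, if_neg hT]
    refine le_lintegral_expMeasure (exitRate_pos hs) (M.exitRate_le_rateMax hs) hδ ?_
      (hm.comp (measurable_stamp s')) ?_ ?_
    · have := elapsed_le_digCount hδ w
      rw [Nat.cast_sub hd]
      linarith
    · intro t ht
      have ht0 : 0 ≤ t := by linarith [not_lt.1 hT]
      have h1 : k * δ < elapsed (w ++ [((Sum.inr t.toNNReal, s') : TStep S Act)]) := by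
        rw [elapsed_append_singleton]
        simp only [Stamp.time, Real.coe_toNNReal t ht0]
        linarith
      rw [potential, if_pos (noOverrun_append_singleton.2 ⟨hn, fun h => h1.not_ge h.1⟩), if_pos h1]
    · intro t ht0 htj htR
      have e1 : elapsed (w ++ [((Sum.inr t.toNNReal, s') : TStep S Act)]) = elapsed w + t := by
        rw [elapsed_append_singleton]
        simp only [Stamp.time, Real.coe_toNNReal t ht0]
      have e2 : digCount δ (w ++ [((Sum.inr t.toNNReal, s') : TStep S Act)]) =
          digCount δ w + (⌊t / δ⌋₊ + 1) := by
        rw [digCount_append_singleton]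
        simp only [Stamp.cost, Real.coe_toNNReal t ht0]
      rw [potential, if_pos (noOverrun_append_singleton.2 ⟨hn, fun h => ?_⟩), e1, e2,
        if_neg (by linarith)]
      · refine le_of_eq ?_
        congr 3
        · omega
        · ring_nf
      · rw [e2] at h
        omega

-- Expectations of a submartingale do not decrease.
include hδ in
lemma potential_nil_le (k n : ℕ) : potential M.rateMax δ (k * δ) k ([] : List (TStep S Act)) ≤
    ∫⁻ ω, potential M.rateMax δ (k * δ) k (pref ω n) ∂(M.prob σ) := by
  induction n with
  | zero => simp
  | succ n ih =>
    refine ih.trans ?_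
    simp only [pref_succ]
    rw [prob, (M.stepLaw σ).lintegral_step n (f := fun w y =>
      potential M.rateMax δ (k * δ) k (w ++ [y])) (measurable_potential_append _ _ _ _ n)]
    exact lintegral_mono fun ω => M.potential_le_lintegral hδ σ k (pref ω n)

include hδ in
/-- The probability that more than `k` digitization steps take place within time `k * δ`. -/
theorem measure_overrun_le (k : ℕ) :
    M.prob σ {ω | ∃ n, elapsed (pref ω n) ≤ k * δ ∧ k < digCount δ (pref ω n)} ≤
      ENNReal.ofReal (1 - (1 + M.rateMax * δ) ^ k * Real.exp (-(M.rateMax * (k * δ)))) := by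
  classical
  have hmeas : ∀ n, MeasurableSet {ω : ℕ → TStep S Act | NoOverrun δ (k * δ) k (pref ω n)} := by
    intro n
    exact (by fun_prop : Measurable fun (ω : ℕ → TStep S Act) (i : Fin n) => ω i)
      (measurableSet_noOverrun δ (k * δ) k n)
  have h0 : potential M.rateMax δ (k * δ) k ([] : List (TStep S Act)) =
      ENNReal.ofReal ((1 + M.rateMax * δ) ^ k * Real.exp (-(M.rateMax * (k * δ)))) := by
    have h1 : NoOverrun δ (k * δ) k ([] : List (TStep S Act)) := by
      intro l hl
      rw [List.prefix_nil.1 hl]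
      simp
    have h2 : ¬ (k * δ < elapsed ([] : List (TStep S Act))) := by
      simp only [elapsed_nil, not_lt]
      positivity
    rw [potential, if_pos h1, if_neg h2]
    simp
  have hle : ∀ n, M.prob σ {ω | NoOverrun δ (k * δ) k (pref ω n)}ᶜ ≤
      ENNReal.ofReal (1 - (1 + M.rateMax * δ) ^ k * Real.exp (-(M.rateMax * (k * δ)))) := by
    intro n
    have hL := M.rateMax_nonneg
    rw [prob_compl_eq_one_sub (hmeas n), ENNReal.ofReal_sub _ (by positivity), ← h0,
      ENNReal.ofReal_one]
    refine tsub_le_tsub_left ?_ _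
    refine (M.potential_nil_le hδ σ k n).trans ?_
    rw [← lintegral_indicator_one (hmeas n)]
    refine lintegral_mono fun ω => (potential_le hL hδ k _).trans (le_of_eq ?_)
    simp [Set.indicator_apply]
  have hsub : {ω | ∃ n, elapsed (pref ω n) ≤ k * δ ∧ k < digCount δ (pref ω n)} ⊆
      ⋃ n, {ω : ℕ → TStep S Act | NoOverrun δ (k * δ) k (pref ω n)}ᶜ := by
    rintro ω ⟨n, hn⟩
    exact Set.mem_iUnion.2 ⟨n, fun h => h _ List.prefix_rfl hn⟩
  -- An overrun persists in longer prefixes, so the bound, uniform in `n`, passes to the union.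
  have hmono : Monotone fun n => {ω : ℕ → TStep S Act | NoOverrun δ (k * δ) k (pref ω n)}ᶜ := by
    refine monotone_nat_of_le_succ fun n ω hω h => hω ?_
    rw [Set.mem_ofPred_eq, pref_succ] at h
    exact (noOverrun_append_singleton.1 h).1
  refine (measure_mono hsub).trans ?_
  rw [hmono.measure_iUnion]
  exact iSup_le hle

/-! ### Sojourns that end in a given digitization step -/

/-- The steps that complete a sojourn during the digitization step number `k`. -/
def jumpSteps (δ : ℝ) (k : ℕ) (w : List (TStep S Act)) : Set (TStep S Act) :=
  {y | lastState M.init w ∈ M.MS ∧ y.1.isLeft = false ∧ digCount δ w + y.1.units δ = k}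

/-- The steps for which the sojourn lasts until the beginning of the digitization step number `k`
at least. -/
def staySteps (δ : ℝ) (k : ℕ) (w : List (TStep S Act)) : Set (TStep S Act) :=
  {y | lastState M.init w ∈ M.MS ∧ y.1.isLeft = false ∧ digCount δ w ≤ k ∧
    k ≤ digCount δ w + y.1.units δ}

lemma measurableSet_digCount_step (δ : ℝ) (n : ℕ) (B : S → Bool → ℕ → ℕ → Prop) :
    MeasurableSet {z : (Fin n → TStep S Act) × TStep S Act |
      B (lastState M.init (List.ofFn z.1)) z.2.1.isLeft (digCount δ (List.ofFn z.1))
        (z.2.1.units δ)} := by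
  have h2 := measurable_lastState (B := Stamp Act) M.init n
  have h3 : Measurable fun κ : Stamp Act => κ.isLeft :=
    (measurable_const.sumElim measurable_const :
      Measurable (Sum.elim (fun _ : Act => true) (fun _ : ℝ≥0 => false)))
  have h4 : Measurable fun z : (Fin n → TStep S Act) × TStep S Act => z.2.1 := by fun_prop
  have h5 : Measurable fun z : (Fin n → TStep S Act) × TStep S Act =>
      ((lastState M.init (List.ofFn z.1), z.2.1.isLeft), digCount δ (List.ofFn z.1),
        z.2.1.units δ) :=
    ((h2.comp measurable_fst).prodMk (h3.comp h4)).prodMk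
      (((measurable_digCount δ n).comp measurable_fst).prodMk ((measurable_units δ).comp h4))
  exact h5 (MeasurableSet.of_discrete
    (s := {y : (S × Bool) × ℕ × ℕ | B y.1.1 y.1.2 y.2.1 y.2.2}))

lemma measurableSet_jumpSteps_prod (δ : ℝ) (k n : ℕ) :
    MeasurableSet {z : (Fin n → TStep S Act) × TStep S Act |
      z.2 ∈ M.jumpSteps δ k (List.ofFn z.1)} :=
  M.measurableSet_digCount_step δ n fun s b d u => s ∈ M.MS ∧ b = false ∧ d + u = k

lemma measurableSet_staySteps_prod (δ : ℝ) (k n : ℕ) :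
    MeasurableSet {z : (Fin n → TStep S Act) × TStep S Act |
      z.2 ∈ M.staySteps δ k (List.ofFn z.1)} :=
  M.measurableSet_digCount_step δ n fun s b d u => s ∈ M.MS ∧ b = false ∧ d ≤ k ∧ k ≤ d + u

-- A sojourn that reaches step `k` ends within that unit with probability 1-e^{-rδ}, by the
-- geometric law, and this is increasing in the rate `r`.
include hδ in
lemma stepMeasure_jumpSteps_le (k : ℕ) (w : List (TStep S Act)) :
    M.stepMeasure σ w (M.jumpSteps δ k w) ≤
      ENNReal.ofReal (1 - Real.exp (-(M.rateMax * δ))) *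
        M.stepMeasure σ w (M.staySteps δ k w) := by
  by_cases h : lastState M.init w ∈ M.MS ∧ digCount δ w ≤ k
  swap
  · have : M.jumpSteps δ k w = ∅ := Set.eq_empty_of_forall_notMem fun y ⟨h1, _, h2⟩ =>
      h ⟨h1, by omega⟩
    simp [this]
  obtain ⟨hs, hk⟩ := h
  have hm1 : MeasurableSet (M.jumpSteps δ k w) := by
    have := (measurable_prodMk_left (x := w.get)) (M.measurableSet_jumpSteps_prod δ k w.length)
    simpa [List.ofFn_get] using this
  have hm2 : MeasurableSet (M.staySteps δ k w) := by
    have := (measurable_prodMk_left (x := w.get)) (M.measurableSet_staySteps_prod δ k w.length)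
    simpa [List.ofFn_get] using this
  have hr := exitRate_pos hs
  rw [stepMeasure_apply_MS M σ hs hm1, stepMeasure_apply_MS M σ hs hm2, Finset.mul_sum]
  refine Finset.sum_le_sum fun s' _ => ?_
  rw [mul_left_comm]
  refine mul_le_mul_right ?_ _
  have e1 : {t : ℝ | ((Sum.inr t.toNNReal, s') : TStep S Act) ∈ M.jumpSteps δ k w} =
      {t | ⌊(t.toNNReal : ℝ) / δ⌋₊ = k - digCount δ w} := by
    ext t
    simp only [jumpSteps, Set.mem_ofPred_eq, hs, Sum.isLeft_inr, true_and, Stamp.units, Stamp.time]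
    omega
  have e2 : {t : ℝ | ((Sum.inr t.toNNReal, s') : TStep S Act) ∈ M.staySteps δ k w} =
      {t | k - digCount δ w ≤ ⌊(t.toNNReal : ℝ) / δ⌋₊} := by
    ext t
    simp only [staySteps, Set.mem_ofPred_eq, hs, Sum.isLeft_inr, true_and, Stamp.units, Stamp.time]
    omega
  rw [e1, e2, expMeasure_floor_eq hr hδ, expMeasure_le_floor hr hδ, mul_comm]
  refine mul_le_mul_left (ENNReal.ofReal_le_ofReal ?_) _
  have := M.exitRate_le_rateMax hs
  gcongr

include hδ in
/-- The probability that a sojourn is completed during the digitization step number `k`. -/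
theorem measure_jump_le (k : ℕ) : M.prob σ {ω | ∃ n, ω n ∈ M.jumpSteps δ k (pref ω n)} ≤
    ENNReal.ofReal (1 - Real.exp (-(M.rateMax * δ))) := by
  set F := ENNReal.ofReal (1 - Real.exp (-(M.rateMax * δ)))
  have hle : ∀ n, M.prob σ {ω | ω n ∈ M.jumpSteps δ k (pref ω n)} ≤
      F * M.prob σ {ω | ω n ∈ M.staySteps δ k (pref ω n)} := by
    intro n
    rw [prob, (M.stepLaw σ).measure_step n (A := fun w y => y ∈ M.jumpSteps δ k w)
      (M.measurableSet_jumpSteps_prod δ k n),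
      (M.stepLaw σ).measure_step n (A := fun w y => y ∈ M.staySteps δ k w)
      (M.measurableSet_staySteps_prod δ k n), ← lintegral_const_mul' _ _ ENNReal.ofReal_ne_top]
    exact lintegral_mono fun ω => M.stepMeasure_jumpSteps_le hδ σ k _
  have hmono : ∀ ω : ℕ → TStep S Act, Monotone fun n => digCount δ (pref ω n) := fun ω =>
    monotone_nat_of_le_succ fun n => by rw [pref_succ, digCount_append_singleton]; omega
  -- After a sojourn that reaches step `k` the count exceeds `k`, so no later sojourn can cover that
  -- step. Hence the events sum to at most one.
  have hdisj : Pairwise (Function.onFun Disjoint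
      fun n => {ω : ℕ → TStep S Act | ω n ∈ M.staySteps δ k (pref ω n)}) := by
    have key : ∀ n m (ω : ℕ → TStep S Act), n < m → ω n ∈ M.staySteps δ k (pref ω n) →
        ω m ∉ M.staySteps δ k (pref ω m) := by
      rintro n m ω hnm ⟨_, h1, _, h2⟩ ⟨_, _, h3, _⟩
      have h4 := hmono ω (Nat.succ_le_of_lt hnm)
      simp only [Nat.succ_eq_add_one, pref_succ, digCount_append_singleton] at h4
      rw [Stamp.cost_eq δ (by simpa using h1)] at h4
      omega
    intro n m hnm
    rw [Function.onFun, Set.disjoint_left]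
    intro ω h1 h2
    rcases lt_or_gt_of_ne hnm with h | h
    · exact key n m ω h h1 h2
    · exact key m n ω h h2 h1
  have hmeas : ∀ n, MeasurableSet {ω : ℕ → TStep S Act | ω n ∈ M.staySteps δ k (pref ω n)} := by
    intro n
    exact (by fun_prop : Measurable fun ω : ℕ → TStep S Act => ((fun i : Fin n => ω i), ω n))
      (M.measurableSet_staySteps_prod δ k n)
  calc M.prob σ {ω | ∃ n, ω n ∈ M.jumpSteps δ k (pref ω n)}
      ≤ ∑' n, M.prob σ {ω | ω n ∈ M.jumpSteps δ k (pref ω n)} := by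
        rw [Set.ofPred_exists]
        exact measure_iUnion_le _
    _ ≤ ∑' n, F * M.prob σ {ω | ω n ∈ M.staySteps δ k (pref ω n)} := ENNReal.tsum_le_tsum hle
    _ = F * M.prob σ (⋃ n, {ω | ω n ∈ M.staySteps δ k (pref ω n)}) := by
        rw [ENNReal.tsum_mul_left, measure_iUnion hdisj hmeas]
    _ ≤ F * 1 := mul_le_mul_right prob_le_one _
    _ = F := mul_one _

end MarkovAutomaton

/-! ### Prefixes, strict rounding and end points -/

section Prefix

lemma take_pref {X : Type*} (ω : ℕ → X) {i n : ℕ} (h : i ≤ n) :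
    (pref ω n).take i = pref ω i := by
  induction n with
  | zero => simp [Nat.le_zero.1 h]
  | succ n ih =>
    rcases h.lt_or_eq with h | rfl
    · rw [pref_succ, List.take_append_of_le_length (by simp; omega), ih (by omega)]
    · exact List.take_of_length_le (by simp)

/-- The floor plus one exceeds its argument strictly, so a single sojourn makes the inequality
strict. This excludes probabilistic states at the left end point. -/
lemma elapsed_lt_digCount {S Act : Type*} {δ : ℝ} (hδ : 0 < δ) (l : List (TStep S Act))
    (h : 0 < digCount δ l) : elapsed l < digCount δ l * δ := by
  induction l using List.reverseRecOn with
  | nil => simp at h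
  | append_singleton l x ih =>
    have h1 := elapsed_le_digCount hδ l
    rw [elapsed_append_singleton]
    rw [digCount_append_singleton] at h ⊢
    obtain ⟨κ, s⟩ := x
    rcases κ with α | t
    · simp only [Stamp.cost_inl, add_zero] at h ⊢
      simpa [Stamp.time] using ih h
    · have h2 := Nat.lt_floor_add_one ((t : ℝ) / δ)
      rw [div_lt_iff₀ hδ] at h2
      simp only [Stamp.time, Stamp.cost, Nat.cast_add, Nat.cast_one]
      linarith

end Prefix

namespace TimeInterval

lemma WellFormed.exists_lower_div_eq {δ : ℝ} {I : TimeInterval} (hI : I.WellFormed δ) :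
    ∃ k : ℕ, I.lower / δ = k := by
  rcases I with ⟨a, b, ha, hab⟩ | ⟨a, ha⟩
  · exact hI.1
  · exact hI

lemma WellFormed.exists_lower_eq {δ : ℝ} (hδ : 0 < δ) {I : TimeInterval} (hI : I.WellFormed δ) :
    ∃ k : ℕ, I.lower = k * δ ∧ ⌊I.lower / δ⌋₊ = k := by
  obtain ⟨k, hk⟩ := hI.exists_lower_div_eq
  exact ⟨k, by rw [← hk, div_mul_cancel₀ _ hδ.ne'], by simp [hk]⟩

end TimeInterval

namespace MarkovAutomaton

variable {S Act : Type*} [Fintype S] [Fintype Act] (M : MarkovAutomaton S Act)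
  {δ : ℝ} (hδ : 0 < δ)

lemma stateAt_congr {B : Type*} {s : S} {ω ω' : ℕ → B × S} {n : ℕ} (h : pref ω n = pref ω' n) :
    stateAt s ω n = stateAt s ω' n := by
  rw [← lastState_pref, h, lastState_pref]

lemma numDS_congr {ω ω' : ℕ → DStep S Act} {n : ℕ} (h : pref ω n = pref ω' n) :
    M.numDS ω n = M.numDS ω' n := by
  classical
  rw [numDS, numDS]
  congr 1
  refine Finset.filter_congr fun i hi => ?_
  have hin : i ≤ n := (Finset.mem_range.1 hi).le
  rw [stateAt_congr (ω' := ω')]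
  rw [← take_pref ω hin, h, take_pref ω' hin]

variable [MeasurableSpace S] [MeasurableSingletonClass S]
  [MeasurableSpace Act] [MeasurableSingletonClass Act] (σ : M.Scheduler) (hM : M.NonZeno)

/-! ### Transfer of reachability to timed runs -/

section Transfer

variable {τ : (M.dig δ hδ).Scheduler} (hτ : M.IsDigitization δ hδ σ τ)

include hM hτ in
/-- Events that are determined by some finite prefix have the same probability in the digitized
automaton and for the digitization of the timed run. -/
lemma measure_exists_pref (Q : Set (List (DStep S Act))) :
    (M.dig δ hδ).prob τ (cyl Q) = M.prob σ (M.digRun δ ⁻¹' cyl Q) := by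
  -- The minimal elements of `Q` in prefix order have disjoint cylinders that cover the event. There
  -- are countably many, so agreement of the laws on single cylinders suffices.
  let A : Set (List (DStep S Act)) := {p | p ∈ Q ∧ ∀ i < p.length, p.take i ∉ Q}
  have hcyl : cyl Q = ⋃ p ∈ A, {ω | pref ω p.length = p} := by
    classical
    ext ω
    simp only [Set.mem_iUnion, exists_prop, Set.mem_ofPred_eq]
    constructor
    · intro h
      change ∃ n, pref ω n ∈ Q at h
      refine ⟨pref ω (Nat.find h), ⟨Nat.find_spec h, fun i hi hQ => ?_⟩, by simp⟩
      rw [length_pref] at hi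
      rw [take_pref ω hi.le] at hQ
      exact Nat.find_min h hi hQ
    · rintro ⟨p, hp, h⟩
      exact ⟨p.length, by rw [h]; exact hp.1⟩
  have key : ∀ p q, p ∈ A → q ∈ A → p.length ≤ q.length → ∀ ω : ℕ → DStep S Act,
      pref ω p.length = p → pref ω q.length = q → p = q := by
    intro p q hp hq hle ω h1 h2
    have h3 : q.take p.length = p := by rw [← h2, take_pref ω hle, h1]
    rcases hle.lt_or_eq with h | h
    · exact absurd (h3.symm ▸ hp.1 : q.take p.length ∈ Q) (hq.2 _ h)
    · rw [← h3, h, List.take_length]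
  have hdisj : A.PairwiseDisjoint fun p => {ω : ℕ → DStep S Act | pref ω p.length = p} := by
    intro p hp q hq hne
    rw [Function.onFun, Set.disjoint_left]
    intro ω h1 h2
    rcases le_total p.length q.length with h | h
    · exact hne (key p q hp hq h ω h1 h2)
    · exact hne (key q p hq hp h ω h2 h1).symm
  have hA : A.Countable := Set.to_countable A
  have hm : ∀ p : List (DStep S Act), MeasurableSet {ω : ℕ → DStep S Act | pref ω p.length = p} := by
    intro p
    exact (by fun_prop : Measurable fun (ω : ℕ → DStep S Act) (i : Fin p.length) => ω i)
      (Set.toFinite {v : Fin p.length → DStep S Act | List.ofFn v = p}).measurableSet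
  rw [hcyl, Set.preimage_iUnion₂, measure_biUnion hA hdisj fun p _ => hm p,
    measure_biUnion hA (fun p hp q hq hne => (hdisj hp hq hne).preimage _)
      fun p _ => M.measurableSet_pref_digRun p]
  exact tsum_congr fun p => (M.measure_digRun_cyl hδ σ hM hτ p).symm

-- Step-bounded reachability depends on a finite prefix only, so it transfers to the digitized run
-- and can then be read off the timed run by `exists_stateAt_digRun_iff`.
include hM hτ in
lemma measure_dsReach (J : Set ℕ) (G : Set S) :
    (M.dig δ hδ).prob τ (M.dsReach δ hδ J G) =
      M.prob σ {ω | ∃ n, stateAt M.init ω n ∈ G ∧ ∃ j ≤ (ω n).1.units δ,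
        digCount δ (pref ω n) + j ∈ J} := by
  have h1 : ∀ ω : ℕ → DStep S Act,
      ω ∈ cyl {p : List (DStep S Act) | ∃ ω', pref ω' p.length = p ∧
        stateAt M.init ω' p.length ∈ G ∧ M.numDS ω' p.length ∈ J} ↔
      ∃ n, stateAt M.init ω n ∈ G ∧ M.numDS ω n ∈ J := by
    intro ω
    refine exists_congr fun n => ?_
    simp only [Set.mem_ofPred_eq, length_pref]
    constructor
    · rintro ⟨ω', h, hG, hJ⟩
      rw [stateAt_congr h] at hG
      rw [M.numDS_congr h] at hJ
      exact ⟨hG, hJ⟩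
    · exact fun h => ⟨ω, rfl, h⟩
  rw [measure_congr (t := cyl {p : List (DStep S Act) | ∃ ω', pref ω' p.length = p ∧
        stateAt M.init ω' p.length ∈ G ∧ M.numDS ω' p.length ∈ J}),
    M.measure_exists_pref hδ σ hM hτ]
  · refine measure_congr ?_
    filter_upwards [M.ae_mem_IPaths σ hM] with ω hω
    refine propext ((h1 _).trans ?_)
    exact M.exists_stateAt_digRun_iff (fun n => fits_of_mem_IPaths hω n) J G
  · filter_upwards [(M.dig δ hδ).ae_mem_IPaths τ] with ω hω
    exact propext (Iff.trans ⟨fun h => h.2, fun h => ⟨hω, h⟩⟩ (h1 ω).symm)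

end Transfer

/-! ### Existence of a digitization of the scheduler -/

section Existence

-- On the cylinder the choice is that of `σ` after one induced prefix ending in the same state,
-- hence a distribution on the same enabled actions; averaging preserves this.
include hM in
lemma isDistOn_integral_choiceAlong {p : List (DStep S Act)} (hp : lastState M.init p ∈ M.PS)
    (h0 : M.prob σ (cyl (M.induced δ p)) ≠ 0) :
    IsDistOn (fun α => ∫ ω, M.choiceAlong δ σ p α ω ∂((M.prob σ)[|cyl (M.induced δ p)]))
      ((M.dig δ hδ).enabled (lastState M.init p)) where
  nonneg α := integral_nonneg fun ω => M.choiceAlong_nonneg σ p α ω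
  sum_one := by
    have := cond_isProbabilityMeasure h0
    have hac : (M.prob σ)[|cyl (M.induced δ p)] ≪ M.prob σ := cond_absolutelyContinuous
    have hnull : NullMeasurableSet (cyl (M.induced δ p)) (M.prob σ) :=
      (M.measurableSet_pref_digRun p).nullMeasurableSet.congr (M.cyl_induced_ae_eq σ hM hp).symm
    have hmem : ∀ᵐ ω ∂((M.prob σ)[|cyl (M.induced δ p)]), ω ∈ cyl (M.induced δ p) :=
      Measure.ae_smul_measure (ae_restrict_mem₀ hnull) _
    rw [← integral_finsetSum]
    · rw [integral_congr_ae (g := fun _ => 1)]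
      · simp
      · filter_upwards [hmem] with ω hω
        obtain ⟨n, -, h⟩ := M.exists_choiceAlong_eq σ hω
        simp_rw [h]
        exact (σ.isDist _).sum_one
    · intro α _
      exact ((M.integrable_choiceAlong σ hM p α).restrict).smul_measure (ENNReal.inv_ne_top.2 h0)
  support α hα := by
    rw [M.dig_enabled_PS hδ hp] at hα
    refine integral_eq_zero_of_ae (Filter.Eventually.of_forall fun ω => ?_)
    by_cases hω : ω ∈ cyl (M.induced δ p)
    · obtain ⟨n, h1, h2⟩ := M.exists_choiceAlong_eq σ hω
      rw [h2]
      exact (σ.isDist _).support α (by rwa [h1])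
    · exact M.choiceAlong_eq_zero σ α hω

include hM in
theorem exists_isDigitization : ∃ τ, M.IsDigitization δ hδ σ τ := by
  classical
  have key : ∀ p : List (DStep S Act), ∃ f : Act → ℝ,
      IsDistOn f ((M.dig δ hδ).enabled (lastState M.init p)) ∧
      (lastState M.init p ∈ M.PS → M.prob σ (cyl (M.induced δ p)) ≠ 0 → ∀ α,
        f α = ∫ ω, M.choiceAlong δ σ p α ω ∂((M.prob σ)[|cyl (M.induced δ p)])) := by
    intro p
    by_cases h : lastState M.init p ∈ M.PS ∧ M.prob σ (cyl (M.induced δ p)) ≠ 0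
    · exact ⟨_, M.isDistOn_integral_choiceAlong hδ σ hM h.1 h.2, fun _ _ _ => rfl⟩
    -- Where nothing is prescribed, any enabled action is taken with probability one.
    · obtain ⟨α, hα⟩ := M.dig_enabled_nonempty hδ (lastState M.init p)
      refine ⟨Pi.single α 1, ⟨fun β => ?_, by simp, fun β hβ => ?_⟩,
        fun h1 h2 => absurd ⟨h1, h2⟩ h⟩
      · by_cases hb : β = α
        · subst hb; simp
        · simp [hb]
      · rw [Pi.single_eq_of_ne]
        rintro rfl
        exact hβ hα
  choose f hf using key
  exact ⟨⟨f, fun p => (hf p).1⟩, fun p _ hp h0 => (hf p).2 hp h0⟩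

end Existence

/-! ### Pathwise comparison of the two events -/

section Comparison

open TimeInterval

variable {I : TimeInterval} {G : Set S} {ω : ℕ → TStep S Act}

include hδ in
/-- A run that reaches `G` in time reaches it within the corresponding number of digitization
steps, unless the run is too fast or completes a sojourn around the left end point. -/
lemma exists_digSteps_of_timedReach (hI : I.WellFormed δ) (h : ω ∈ M.timedReach I.toSet G) :
    (∃ n, stateAt M.init ω n ∈ G ∧ ∃ j ≤ (ω n).1.units δ,
      digCount δ (pref ω n) + j ∈ I.digSteps δ) ∨
    (0 < I.lower ∧ ∃ n, ω n ∈ M.jumpSteps δ ⌊I.lower / δ⌋₊ (pref ω n)) ∨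
    ∃ a b ha hab, I = .bounded a b ha hab ∧
      ∃ n, elapsed (pref ω n) ≤ ⌊b / δ⌋₊ * δ ∧ ⌊b / δ⌋₊ < digCount δ (pref ω n) := by
  obtain ⟨hω, n, hG, t, htI, ht1, ht2⟩ := h
  rw [← elapsed_pref] at ht1 ht2
  have hT := elapsed_le_digCount hδ (pref ω n)
  have hfit := fits_of_mem_IPaths hω n
  set d := digCount δ (pref ω n) with hd
  set T := elapsed (pref ω n) with hTdef
  have hunits : ((ω n).1.time : ℝ) < ((ω n).1.units δ + 1) * δ := by
    have := Nat.lt_floor_add_one (((ω n).1.time : ℝ) / δ)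
    rwa [div_lt_iff₀ hδ] at this
  obtain ⟨ka, hka, hka'⟩ := hI.exists_lower_eq hδ
  have hlt : I.lower ≤ t := by
    rcases I with ⟨a, b, ha, hab⟩ | ⟨a, ha⟩
    · exact htI.1
    · exact htI
  -- The visit lasts until time a at least, but its step counts do not go beyond `ka`. Rounding up
  -- leaves only the count `ka` for its last unit, so the sojourn ends in that very step.
  by_cases hlate : d + (ω n).1.units δ ≤ ka ∧ 0 < I.lower
  · right; left
    refine ⟨hlate.2, n, ?_⟩
    rw [hka']
    have hka0 : 0 < ka := by
      have := hlate.2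
      rw [hka] at this
      exact_mod_cast pos_of_mul_pos_left this hδ.le
    have h1 : (ka : ℝ) * δ < (d + (ω n).1.units δ + 1 : ℕ) * δ := by
      push_cast
      linarith
    have h2 : ka < d + (ω n).1.units δ + 1 := by
      exact_mod_cast lt_of_mul_lt_mul_right h1 hδ.le
    have hs : stateAt M.init ω n ∈ M.MS := by
      by_contra hs
      obtain ⟨α, hα⟩ := hfit.eq_inl hs
      have hu : (ω n).1.units δ = 0 := by rw [hα, Stamp.units_inl]
      have ht0 : ((ω n).1.time : ℝ) = 0 := by rw [hα]; rfl
      have hd' : d = ka := by omega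
      have := elapsed_lt_digCount hδ (pref ω n) (by omega)
      rw [← hd, ← hTdef, hd'] at this
      linarith
    refine ⟨by rwa [lastState_pref], ?_, by omega⟩
    simpa using hfit.2 hs
  -- The earliest admissible count is the witness: max(d, ka + 1) if a > 0, and d itself if a = 0.
  · have hJ : ∃ j ≤ (ω n).1.units δ, (0 < I.lower → ka < d + j) ∧
        (d + j = d ∨ (0 < I.lower ∧ d + j = ka + 1)) ∧ ka ≤ d + j := by
      by_cases h0 : 0 < I.lower
      · have : ka < d + (ω n).1.units δ := not_le.1 fun h => hlate ⟨h, h0⟩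
        refine ⟨ka + 1 - d, by omega, fun _ => by omega, ?_, by omega⟩
        by_cases h : ka + 1 ≤ d
        · left; omega
        · right; exact ⟨h0, by omega⟩
      · refine ⟨0, Nat.zero_le _, fun h => absurd h h0, Or.inl rfl, ?_⟩
        have : (ka : ℝ) * δ ≤ 0 := by rw [← hka]; exact not_lt.1 h0
        have : (ka : ℝ) ≤ 0 := nonpos_of_mul_nonpos_left this hδ
        have : ka = 0 := by exact_mod_cast le_antisymm this (Nat.cast_nonneg _)
        omega
    obtain ⟨j, hj, hj1, hj2, hj3⟩ := hJ
    have hge : I.lower ≤ ((d + j : ℕ) : ℝ) * δ := by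
      rw [hka]
      have : (ka : ℝ) ≤ ((d + j : ℕ) : ℝ) := by exact_mod_cast hj3
      gcongr
    have hne : ¬ (0 < I.lower ∧ ((d + j : ℕ) : ℝ) * δ = I.lower) := by
      rintro ⟨h0, h1⟩
      rw [hka] at h1
      have : d + j = ka := by exact_mod_cast mul_right_cancel₀ hδ.ne' h1
      have := hj1 h0
      omega
    rcases I with ⟨a, b, ha, hab⟩ | ⟨a, ha⟩
    · obtain ⟨-, kb, hkb⟩ := hI
      have hb : b = kb * δ := by rw [← hkb, div_mul_cancel₀ _ hδ.ne']
      have hfb : ⌊b / δ⌋₊ = kb := by simp [hkb]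
      -- If d ≤ kb, the chosen count is at most kb too, since ka + 1 ≤ kb. Otherwise the state is
      -- entered by time b after more than kb steps.
      by_cases hover : kb < d
      · right; right
        refine ⟨a, b, ha, hab, rfl, n, ?_, ?_⟩
        · rw [hfb, ← hb, ← hTdef]
          exact ht1.trans htI.2
        · rw [hfb]
          exact hover
      · left
        refine ⟨n, hG, j, hj, ⟨hge, ?_⟩, hne⟩
        have hkab : ka < kb := by
          have h1 : (ka : ℝ) * δ < kb * δ := by
            rw [← hka, ← hb]
            exact hab
          exact_mod_cast lt_of_mul_lt_mul_right h1 hδ.le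
        have : d + j ≤ kb := by omega
        have : ((d + j : ℕ) : ℝ) ≤ kb := by exact_mod_cast this
        rw [hb]
        gcongr
    · left
      exact ⟨n, hG, j, hj, hge, hne⟩

include hδ in
/-- A run that reaches `G` within the right number of digitization steps reaches it in time, unless
the run is too fast. -/
lemma timedReach_of_digSteps (hI : I.WellFormed δ) (hω : ω ∈ M.IPaths)
    (h : ∃ n, stateAt M.init ω n ∈ G ∧ ∃ j ≤ (ω n).1.units δ,
      digCount δ (pref ω n) + j ∈ I.digSteps δ) :
    ω ∈ M.timedReach I.toSet G ∨
    (0 < I.lower ∧ ∃ n, elapsed (pref ω n) ≤ ⌊I.lower / δ⌋₊ * δ ∧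
      ⌊I.lower / δ⌋₊ < digCount δ (pref ω n)) := by
  obtain ⟨n, hG, j, hj, hJ, hne⟩ := h
  have hT := elapsed_le_digCount hδ (pref ω n)
  set d := digCount δ (pref ω n) with hd
  set T := elapsed (pref ω n) with hTdef
  have hT0 : 0 ≤ T := by
    rw [hTdef, elapsed_pref]
    exact Finset.sum_nonneg fun i _ => NNReal.coe_nonneg _
  have ht0 : (0 : ℝ) ≤ (ω n).1.time := NNReal.coe_nonneg _
  obtain ⟨ka, hka, hka'⟩ := hI.exists_lower_eq hδ
  have hle : I.lower ≤ ((d + j : ℕ) : ℝ) * δ := by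
    rcases I with ⟨a, b, ha, hab⟩ | ⟨a, ha⟩
    · exact hJ.1
    · exact hJ
  have hTj : T ≤ ((d + j : ℕ) : ℝ) * δ := by
    have : (0 : ℝ) ≤ j * δ := by positivity
    push_cast
    linarith
  by_cases hlate : I.lower ≤ T + (ω n).1.time
  · left
    -- The first moment of the visit that is not before a; it is at most b because elapsed time is
    -- at most digital time.
    refine ⟨hω, n, hG, max I.lower T, ?_, ?_⟩
    · rcases I with ⟨a, b, ha, hab⟩ | ⟨a, ha⟩
      · exact ⟨le_max_left _ _, max_le hab.le (hTj.trans hJ.2)⟩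
      · exact le_max_left a T
    · rw [← elapsed_pref]
      exact ⟨le_max_right _ _, max_le hlate (by linarith)⟩
  · right
    have hlate := not_le.1 hlate
    have h0 : 0 < I.lower := by linarith
    -- The visit is over before time a, yet its counts go beyond `ka`. So the prefix that includes
    -- the completed step is an overrun at a.
    refine ⟨h0, n + 1, ?_, ?_⟩
    · rw [hka', ← hka, pref_succ, elapsed_append_singleton]
      exact hlate.le
    · have h1 : ka ≤ d + j := by
        rw [hka] at hle
        exact_mod_cast le_of_mul_le_mul_right hle hδ
      have h2 : ka ≠ d + j := by
        rintro rfl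
        exact hne ⟨h0, hka.symm⟩
      have h3 : (ω n).1.units δ ≤ (ω n).1.cost δ := by
        rcases (ω n).1 with α | t
        · simp
        · rw [Stamp.cost_inr]; omega
      rw [hka', pref_succ, digCount_append_singleton]
      omega

end Comparison

/-! ### Error bounds as real numbers -/

section Bounds

open TimeInterval

include hδ in
lemma measureReal_overrun_le {t : ℝ} (ht : ∃ k : ℕ, t / δ = k) :
    (M.prob σ).real {ω | ∃ n, elapsed (pref ω n) ≤ ⌊t / δ⌋₊ * δ ∧
      ⌊t / δ⌋₊ < digCount δ (pref ω n)} ≤ stepError M.rateMax δ t := by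
  obtain ⟨k, hk⟩ := ht
  have ht : t = k * δ := by rw [← hk, div_mul_cancel₀ _ hδ.ne']
  have hL := M.rateMax_nonneg
  have h1 : 0 ≤ stepError M.rateMax δ t := by
    rw [stepError, hk, Nat.floor_natCast, ht, sub_nonneg]
    have h4 : (1 + M.rateMax * δ) ^ k ≤ Real.exp ((k : ℝ) * (M.rateMax * δ)) := by
      rw [Real.exp_nat_mul]
      gcongr
      linarith [Real.add_one_le_exp (M.rateMax * δ)]
    calc _ ≤ Real.exp ((k : ℝ) * (M.rateMax * δ)) * Real.exp (-(M.rateMax * (k * δ))) := by gcongr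
      _ ≤ 1 := by
        rw [← Real.exp_add, Real.exp_le_one_iff]
        linarith
  have h2 := M.measure_overrun_le hδ σ k
  refine ENNReal.toReal_le_of_le_ofReal h1 ?_
  rw [stepError, hk, Nat.floor_natCast, ht]
  exact h2

include hδ in
lemma measureReal_jump_le (k : ℕ) :
    (M.prob σ).real {ω | ∃ n, ω n ∈ M.jumpSteps δ k (pref ω n)} ≤
      1 - Real.exp (-(M.rateMax * δ)) := by
  refine ENNReal.toReal_le_of_le_ofReal (sub_nonneg.2 (Real.exp_le_one_iff.2 ?_))
    (M.measure_jump_le hδ σ k)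
  exact neg_nonpos.2 (mul_nonneg M.rateMax_nonneg hδ.le)

end Bounds

end MarkovAutomaton

end MarkovAut

end


/-! ### The two inequalities -/

open MarkovAut MarkovAutomaton TimeInterval in
theorem mainTheorem2 {S Act : Type*} [Fintype S] [Fintype Act]
    [MeasurableSpace S] [MeasurableSingletonClass S]
    [MeasurableSpace Act] [MeasurableSingletonClass Act]
    (M : MarkovAut.MarkovAutomaton S Act) (hM : M.NonZeno) (σ : M.Scheduler) (G : Set S)
    (δ : ℝ) (hδ : 0 < δ) (I : MarkovAut.TimeInterval) (hI : I.WellFormed δ) :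
    (∃ τ, M.IsDigitization δ hδ σ τ) ∧
    ∀ τ, M.IsDigitization δ hδ σ τ →
      (M.prob σ).real (M.timedReach I.toSet G) ∈ Set.Icc
        (((M.dig δ hδ).prob τ).real (M.dsReach δ hδ (I.digSteps δ) G) - I.errLower M.rateMax δ)
        (((M.dig δ hδ).prob τ).real (M.dsReach δ hδ (I.digSteps δ) G) +
          I.errUpper M.rateMax δ) := by
  refine ⟨M.exists_isDigitization hδ σ hM, fun τ hτ => ?_⟩
  have hreach : ((M.dig δ hδ).prob τ).real (M.dsReach δ hδ (I.digSteps δ) G) =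
      (M.prob σ).real {ω | ∃ n, stateAt M.init ω n ∈ G ∧ ∃ j ≤ (ω n).1.units δ,
        digCount δ (pref ω n) + j ∈ I.digSteps δ} :=
    congrArg ENNReal.toReal (M.measure_dsReach hδ σ hM hτ _ G)
  rw [hreach]
  set D := {ω : ℕ → TStep S Act | ∃ n, stateAt M.init ω n ∈ G ∧ ∃ j ≤ (ω n).1.units δ,
    digCount δ (pref ω n) + j ∈ I.digSteps δ}
  set T := M.timedReach I.toSet G with hT
  let O : ℝ → Set (ℕ → TStep S Act) := fun t => {ω | ∃ n, elapsed (pref ω n) ≤ ⌊t / δ⌋₊ * δ ∧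
      ⌊t / δ⌋₊ < digCount δ (pref ω n)}
  let K : Set (ℕ → TStep S Act) := {ω | ∃ n, ω n ∈ M.jumpSteps δ ⌊I.lower / δ⌋₊ (pref ω n)}
  have hK : (M.prob σ).real K ≤ 1 - Real.exp (-(M.rateMax * δ)) := M.measureReal_jump_le hδ σ _
  -- Inclusions are needed on paths only. Each bound below is then an inclusion in a union with the
  -- exceptional events, followed by subadditivity.
  have hmono : ∀ {A B : Set (ℕ → TStep S Act)}, (∀ ω ∈ M.IPaths, ω ∈ A → ω ∈ B) →
      (M.prob σ).real A ≤ (M.prob σ).real B := by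
    intro A B h
    refine ENNReal.toReal_mono (measure_ne_top _ _) (measure_mono_ae ?_)
    filter_upwards [M.ae_mem_IPaths σ hM] with ω hω hA using h ω hω hA
  constructor
  · rw [sub_le_iff_le_add, errLower]
    split_ifs with h0
    · rw [add_zero]
      refine hmono fun ω hω hD => ?_
      exact (M.timedReach_of_digSteps hδ hI hω hD).resolve_right fun h => h.1.ne' h0
    · have h1 : (M.prob σ).real D ≤ (M.prob σ).real (T ∪ O I.lower) := by
        refine hmono fun ω hω hD => ?_
        exact (M.timedReach_of_digSteps hδ hI hω hD).imp_right fun h => h.2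
      have h2 := measureReal_union_le (μ := M.prob σ) T (O I.lower)
      have h3 := M.measureReal_overrun_le hδ σ hI.exists_lower_div_eq
      linarith
  · have hcov := fun ω (h : ω ∈ T) => M.exists_digSteps_of_timedReach hδ hI h
    rcases I with ⟨a, b, ha, hab⟩ | ⟨a, ha⟩
    · have h3 := M.measureReal_overrun_le hδ σ hI.2
      have hO : ∀ {ω}, (∃ a' b' ha' hab', TimeInterval.bounded a b ha hab =
          .bounded a' b' ha' hab' ∧ ∃ n, elapsed (pref ω n) ≤ ⌊b' / δ⌋₊ * δ ∧
            ⌊b' / δ⌋₊ < digCount δ (pref ω n)) → ω ∈ O b := by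
        rintro ω ⟨a', b', ha', hab', h, hn⟩
        obtain ⟨rfl, rfl⟩ := TimeInterval.bounded.inj h
        exact hn
      rw [errUpper]
      split_ifs with h0
      · have h1 : (M.prob σ).real T ≤ (M.prob σ).real (D ∪ O b) := by
          refine hmono fun ω _ hω => ?_
          rcases hcov ω hω with h | h | h
          · exact Or.inl h
          · exact absurd h0 h.1.ne'
          · exact Or.inr (hO h)
        have h2 := measureReal_union_le (μ := M.prob σ) D (O b)
        linarith
      · have h1 : (M.prob σ).real T ≤ (M.prob σ).real (D ∪ (O b ∪ K)) := by
          refine hmono fun ω _ hω => ?_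
          rcases hcov ω hω with h | h | h
          · exact Or.inl h
          · exact Or.inr (Or.inr h.2)
          · exact Or.inr (Or.inl (hO h))
        have h2 := measureReal_union_le (μ := M.prob σ) D (O b ∪ K)
        have h4 := measureReal_union_le (μ := M.prob σ) (O b) K
        linarith
    · have hO : ∀ {ω : ℕ → TStep S Act}, ¬ (∃ a' b' ha' hab', TimeInterval.unbounded a ha =
          .bounded a' b' ha' hab' ∧ ∃ n, elapsed (pref ω n) ≤ ⌊b' / δ⌋₊ * δ ∧
            ⌊b' / δ⌋₊ < digCount δ (pref ω n)) := by
        rintro ω ⟨a', b', ha', hab', h, hn⟩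
        cases h
      rw [errUpper]
      split_ifs with h0
      · rw [add_zero]
        refine hmono fun ω _ hω => ?_
        rcases hcov ω hω with h | h | h
        · exact h
        · exact absurd h0 h.1.ne'
        · exact absurd h hO
      · have h1 : (M.prob σ).real T ≤ (M.prob σ).real (D ∪ K) := by
          refine hmono fun ω _ hω => ?_
          rcases hcov ω hω with h | h | h
          · exact Or.inl h
          · exact Or.inr h.2
          · exact absurd h hO
        have h2 := measureReal_union_le (μ := M.prob σ) D K
        linarith
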